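/- Let $d\ge 2$ be an integer, $s\in(0,d-1]$, and let $K(x)=x/|x|^{s+1}$, $x\in\mathbb{R}^d\setminus\{0\}$, be the kernel of the $s$-Riesz transform. Measures are non-negative locally finite Borel measures on $\mathbb{R}^d$, $\operatorname{supp}\mu$ is the closed support of $\mu$, and $B(x,r)$ is the open ball. A measure $\mu$ is $\Lambda$-nice if $\mu(B(x,r))\le\Lambda r^s$ for all $x\in\mathbb{R}^d$ and $r>0$. Let $\operatorname{Lip}_0$ be the set of compactly supported Lipschitz functions on $\mathbb{R}^d$. A measure $\mu$ is reflectionless for the $s$-Riesz transform if $(x,y)\mapsto|x-y|^{1-s}$ is locally integrable with respect to $\mu\times\mu$, $\int_{|x|\ge1}|x|^{-s-1}\,d\mu(x)<\infty$, and $\langle R(f\mu),1\rangle_\mu=0$ for every $f\in\operatorname{Lip}_0$ with $\int f\,d\mu=0$. Here $$\langle R(f\mu),1\rangle_\mu=\iint K(x-y)\,\tfrac12\bigl[f(y)\psi(x)-\psi(y)f(x)\bigr]\,d\mu(x)\,d\mu(y)+\int\Bigl(\int K(x-y)f(y)\,d\mu(y)\Bigr)(1-\psi(x))\,d\mu(x),$$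 where $\psi\in\operatorname{Lip}_0$ is identically $1$ on a neighbourhood of $\operatorname{supp}f$ (the value does not depend on the choice of $\psi$). Proposition. Let $\Lambda>0$. For each $\varepsilon>0$ there is a constant $\lambda>0$, depending only on $\varepsilon$, $d$, $s$ and $\Lambda$, such that the following holds for every $\Lambda$-nice reflectionless measure $\mu$ for the $s$-Riesz transform: if $x\in\mathbb{R}^d$ and $r>0$ satisfy $\mu(B(x,r))>\varepsilon r^s$, then there is a ball $B'\subset B(x,3r)$ of radius $\lambda r$ that does not intersect $\operatorname{supp}\mu$. In particular, the support of every $\Lambda$-nice reflectionless measure for the $s$-Riesz transform is nowhere dense. -/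

import Mathlib

open MeasureTheory Filter Topology
open scoped ENNReal

namespace Reflectionless

/-- The kernel `K(x) = x / |x|^(s+1)` of the `s`-dimensional Riesz transform on `ℝ^d`
(with value `0` at the origin). -/
noncomputable def rieszKernel (d : ℕ) (s : ℝ) (x : EuclideanSpace ℝ (Fin d)) :
    EuclideanSpace ℝ (Fin d) :=
  (‖x‖ ^ (s + 1))⁻¹ • x

/-- `μ` is `Λ`-nice (of dimension `s`): `μ(B(x,r)) ≤ Λ r^s` for every ball `B(x,r)`. -/
def IsNice {d : ℕ} (s Λ : ℝ) (μ : Measure (EuclideanSpace ℝ (Fin d))) : Prop :=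
  ∀ (x : EuclideanSpace ℝ (Fin d)) (r : ℝ), 0 < r →
    μ (Metric.ball x r) ≤ ENNReal.ofReal (Λ * r ^ s)

/-- `f ∈ Lip₀(ℝ^d)`: Lipschitz continuous with compact support. -/
def IsLipZero {d : ℕ} (f : EuclideanSpace ℝ (Fin d) → ℝ) : Prop :=
  (∃ C : NNReal, LipschitzWith C f) ∧ HasCompactSupport f

/-- `μ` is diffuse: `(x,y) ↦ 1 / |x-y|^(s-1)` is locally integrable for `μ × μ`.  The power is
taken in `[0,∞]`, so that for `s > 1` it is `∞` on the diagonal. -/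
def IsDiffuse {d : ℕ} (s : ℝ) (μ : Measure (EuclideanSpace ℝ (Fin d))) : Prop :=
  ∀ C : Set (EuclideanSpace ℝ (Fin d) × EuclideanSpace ℝ (Fin d)), IsCompact C →
    ∫⁻ p in C, edist p.1 p.2 ^ (1 - s) ∂(μ.prod μ) < ∞

/-- Restricted growth at infinity: `∫_{|x| ≥ 1} 1 / |x|^(s+α) dμ(x) < ∞`. -/
def HasRestrictedGrowth {d : ℕ} (s α : ℝ) (μ : Measure (EuclideanSpace ℝ (Fin d))) : Prop :=
  ∫⁻ x in {x : EuclideanSpace ℝ (Fin d) | 1 ≤ ‖x‖},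
    ENNReal.ofReal (1 / ‖x‖ ^ (s + α)) ∂μ < ∞

/-- `H_{f,φ}(x,y) = (f(y) φ(x) - φ(y) f(x)) / 2`. -/
noncomputable def antisym {d : ℕ} (f φ : EuclideanSpace ℝ (Fin d) → ℝ)
    (x y : EuclideanSpace ℝ (Fin d)) : ℝ :=
  (1 / 2) * (f y * φ x - φ y * f x)

/-- The pairing `⟨T(fμ), φ⟩_μ = ∬ K(x-y) H_{f,φ}(x,y) dμ(x) dμ(y)` for `f, φ ∈ Lip₀(ℝ^d)`. -/
noncomputable def pairing {d d' : ℕ}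
    (K : EuclideanSpace ℝ (Fin d) → EuclideanSpace ℝ (Fin d'))
    (μ : Measure (EuclideanSpace ℝ (Fin d))) (f φ : EuclideanSpace ℝ (Fin d) → ℝ) :
    EuclideanSpace ℝ (Fin d') :=
  ∫ p : EuclideanSpace ℝ (Fin d) × EuclideanSpace ℝ (Fin d),
    antisym f φ p.1 p.2 • K (p.1 - p.2) ∂(μ.prod μ)

/-- `T(fμ)(x) = ∫ K(x-y) f(y) dμ(y)`, which is used for `x` outside the support of `f`. -/
noncomputable def transform {d d' : ℕ}
    (K : EuclideanSpace ℝ (Fin d) → EuclideanSpace ℝ (Fin d'))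
    (μ : Measure (EuclideanSpace ℝ (Fin d))) (f : EuclideanSpace ℝ (Fin d) → ℝ)
    (x : EuclideanSpace ℝ (Fin d)) : EuclideanSpace ℝ (Fin d') :=
  ∫ y, f y • K (x - y) ∂μ

/-- `ψ ∈ Lip₀(ℝ^d)` is identically `1` on a neighbourhood of the support of `f`. -/
def IsCutoff {d : ℕ} (f ψ : EuclideanSpace ℝ (Fin d) → ℝ) : Prop :=
  IsLipZero ψ ∧ ∀ᶠ x in 𝓝ˢ (tsupport f), ψ x = 1

/-- The pairing `⟨T(fμ), φ⟩_μ` for `f ∈ Lip₀(ℝ^d)` with `∫ f dμ = 0` and a bounded Lipschitz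
function `φ`, computed with the cutoff `ψ` for `f`:
`⟨T(fμ), ψφ⟩_μ + ∫ T(fμ)(x) (1 - ψ(x)) φ(x) dμ(x)`.  Its value does not depend on `ψ`. -/
noncomputable def extendedPairing {d d' : ℕ}
    (K : EuclideanSpace ℝ (Fin d) → EuclideanSpace ℝ (Fin d'))
    (μ : Measure (EuclideanSpace ℝ (Fin d))) (f ψ φ : EuclideanSpace ℝ (Fin d) → ℝ) :
    EuclideanSpace ℝ (Fin d') :=
  pairing K μ f (fun x => ψ x * φ x) + ∫ x, ((1 - ψ x) * φ x) • transform K μ f x ∂μ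

/-- `μ` is reflectionless for the operator with `s`-dimensional kernel `K` of Hölder exponent
`α`: it is diffuse with restricted growth at infinity, and `⟨T(fμ), 1⟩_μ = 0` for every
`f ∈ Lip₀(ℝ^d)` with `∫ f dμ = 0`. -/
def IsReflectionless {d d' : ℕ}
    (K : EuclideanSpace ℝ (Fin d) → EuclideanSpace ℝ (Fin d')) (s α : ℝ)
    (μ : Measure (EuclideanSpace ℝ (Fin d))) : Prop :=
  IsDiffuse s μ ∧ HasRestrictedGrowth s α μ ∧
    ∀ f ψ : EuclideanSpace ℝ (Fin d) → ℝ, IsLipZero f → ∫ x, f x ∂μ = 0 → IsCutoff f ψ →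
      extendedPairing K μ f ψ (fun _ => 1) = 0

/-- `μ` is reflectionless for the `s`-Riesz transform.  The exponent is `α = 1`, as
`|x|^(s+1) K(x) = x` is Lipschitz. -/
def IsRieszReflectionless {d : ℕ} (s : ℝ) (μ : Measure (EuclideanSpace ℝ (Fin d))) : Prop :=
  IsReflectionless (rieszKernel d s) s 1 μ

end Reflectionless

namespace Reflectionless

/-! Two facts about the potential of `μ` conflict when the support of `μ` is too dense. Fix a small
scale `δ = κ r`, truncate the kernel at `δ` to get `K_δ`, and let `U(u) = ∫ (K_δ(y - u) - K_δ(y -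
x₀)) dμ(y)`. Niceness makes this integral converge, and makes `U` vary by at most a multiple of `Λ
|u - v| / δ` over distances `|u - v| ≤ δ`.

Reflectionlessness makes `U` small. Suppose every ball of radius `θ δ` centred in the closed ball
`B(z, 2r)` has positive mass. For `x` there, test the reflectionless condition with `f = φ - χ`,
where `φ` and `χ` are bumps of `μ`-integral one near `x` and near `x₀`. By `integral_identity` the
condition says that `∫ f U dμ` cancels the interaction of `f` through `K - K_δ`, which only sees
pairs at distance less than `δ`. So `U(x)` is close to `U(x₀) = 0` up to that local interaction and
the oscillation of `U`. No lower bound on the mass near `x` is available, so the bumps have to be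
placed at a doubling point and scale (`exists_doubling_point`); then the local interaction of a
normalised bump is at most a multiple of `Λ θ + θ^(-s) (θ δ)^(-s) μ(B(x, 3δ))`
(`exists_normalized_tent`). The last term need not be small for every `x`, but it is on Lebesgue
average: by Fubini the mean of `μ(B(x, 3δ))` over `B(z, 2r)` is of order `κ^d Λ r^s`, so the term
contributes `Λ θ^(-2s) κ^(d-s)`.

The divergence theorem makes `U` large if `μ(B(z, r))` is large. Since `s ≤ d - 1`, the divergence
of `K_δ` is nonnegative, and tested against a tent over `B(z, r)` it gives at least `c r^(d-1-s)`
for each pole in `B(z, r)` (`exists_le_integral_tent_mul_regDiv`). Hence `c r^(d-1-s) μ(B(z, r))` is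
at most `d / r` times the integral of `|U|` over `B(z, 2r)`.

Together, `μ(B(z, r)) ≤ C Λ (θ + θ^(-2s) κ^(d-s)) r^s` (`exists_measureReal_ball_le`). Choosing `θ`
small, and then `κ` small in terms of `θ`, contradicts `μ(B(z, r)) > ε r^s`; so a ball of radius `θ
κ r` misses the support. -/

/-- The Riesz kernel, made Lipschitz by truncating its denominator at scale `δ`. -/
noncomputable def regKernel (d : ℕ) (s δ : ℝ) (x : EuclideanSpace ℝ (Fin d)) :
    EuclideanSpace ℝ (Fin d) :=
  (max ‖x‖ δ ^ (s + 1))⁻¹ • x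

/-! ### The truncated Riesz kernel: size, regularity and divergence. -/

section Kernel

variable {d : ℕ} {s δ : ℝ}

lemma regKernel_neg (x : EuclideanSpace ℝ (Fin d)) :
    regKernel d s δ (-x) = -regKernel d s δ x := by
  simp [regKernel]

lemma regKernel_eq_rieszKernel {x : EuclideanSpace ℝ (Fin d)} (h : δ ≤ ‖x‖) :
    regKernel d s δ x = rieszKernel d s x := by
  rw [regKernel, rieszKernel, max_eq_left h]

lemma norm_rieszKernel (hs : 0 < s) (x : EuclideanSpace ℝ (Fin d)) :
    ‖rieszKernel d s x‖ = ‖x‖ ^ (-s) := by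
  rcases (norm_nonneg x).eq_or_lt with h | h
  -- At the origin both sides are `0`, since the real power `0 ^ (-s)` is `0` for `s ≠ 0`.
  · rw [rieszKernel, norm_smul, ← h, mul_zero, Real.zero_rpow (by linarith)]
  · rw [rieszKernel, norm_smul, norm_inv, Real.norm_of_nonneg (by positivity),
      Real.rpow_add h, Real.rpow_one, Real.rpow_neg h.le]
    field_simp

lemma norm_regKernel_le (hs : 0 < s) (hδ : 0 < δ) (x : EuclideanSpace ℝ (Fin d)) :
    ‖regKernel d s δ x‖ ≤ δ ^ (-s) := by
  have hM : 0 < max ‖x‖ δ := lt_max_of_lt_right hδ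
  have h1 : ‖regKernel d s δ x‖ ≤ (max ‖x‖ δ) ^ (-s) := by
    rw [regKernel, norm_smul, norm_inv, Real.norm_of_nonneg (by positivity),
      Real.rpow_add hM, Real.rpow_one, Real.rpow_neg hM.le, mul_inv, mul_assoc]
    refine mul_le_of_le_one_right (by positivity) ?_
    rw [inv_mul_le_iff₀ hM, mul_one]
    exact le_max_left _ _
  exact h1.trans (Real.rpow_le_rpow_of_nonpos hδ (le_max_right _ _) (by linarith))

lemma norm_rieszKernel_sub_regKernel_le (hs : 0 < s) (hδ : 0 < δ)
    (x : EuclideanSpace ℝ (Fin d)) :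
    ‖rieszKernel d s x - regKernel d s δ x‖ ≤ ‖x‖ ^ (-s) := by
  have hM : 0 < max ‖x‖ δ := lt_max_of_lt_right hδ
  rw [← norm_rieszKernel hs, rieszKernel, regKernel, ← sub_smul, norm_smul, norm_smul]
  rcases (norm_nonneg x).eq_or_lt with h | h
  · simp [← h]
  refine mul_le_mul_of_nonneg_right ?_ h.le
  have h2 : (max ‖x‖ δ ^ (s + 1))⁻¹ ≤ (‖x‖ ^ (s + 1))⁻¹ :=
    inv_anti₀ (by positivity) (Real.rpow_le_rpow h.le (le_max_left _ _) (by linarith))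
  have h3 : 0 < (max ‖x‖ δ ^ (s + 1))⁻¹ := by positivity
  rw [Real.norm_of_nonneg (by linarith), Real.norm_of_nonneg (by positivity)]
  linarith

lemma abs_rpow_neg_sub_rpow_neg_le {p m x y : ℝ} (hp : 0 < p) (hm : 0 < m) (hx : m ≤ x)
    (hy : m ≤ y) : |x ^ (-p) - y ^ (-p)| ≤ p * m ^ (-p - 1) * |x - y| := by
  have := (convex_Ici m).norm_image_sub_le_of_norm_hasDerivWithin_le (f := fun t : ℝ => t ^ (-p))
    (f' := fun t => -p * t ^ (-p - 1)) (C := p * m ^ (-p - 1))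
    (fun t ht => (Real.hasDerivAt_rpow_const
      (Or.inl (hm.trans_le ht).ne')).hasDerivWithinAt) (fun t ht => ?_) hy hx
  · simpa [Real.norm_eq_abs] using this
  · have ht0 : 0 < t := hm.trans_le ht
    rw [norm_mul, norm_neg, Real.norm_of_nonneg hp.le, Real.norm_of_nonneg (by positivity)]
    exact mul_le_mul_of_nonneg_left (Real.rpow_le_rpow_of_nonpos hm ht (by linarith)) hp.le

/-- The two truncated norms are comparable up to the factor `1 + ‖a - b‖ / δ`, so the mean value
bound can be written with `b` alone. No closeness of `a` and `b` is required: the decay of order `s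
+ 1` in `b` makes kernel differences integrable for arbitrary poles. -/
lemma norm_regKernel_sub_le (hs : 0 < s) (hδ : 0 < δ) (a b : EuclideanSpace ℝ (Fin d)) :
    ‖regKernel d s δ a - regKernel d s δ b‖ ≤
      (s + 2) * (1 + ‖a - b‖ / δ) ^ (s + 2) * ‖a - b‖ * max ‖b‖ δ ^ (-(s + 1)) := by
  set N := max ‖a‖ δ with hN
  set M := max ‖b‖ δ with hM
  set D := ‖a - b‖ with hD
  set Q := 1 + D / δ with hQ
  have hD0 : 0 ≤ D := norm_nonneg _
  have hN0 : δ ≤ N := le_max_right _ _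
  have hM0 : δ ≤ M := le_max_right _ _
  have hNpos := hδ.trans_le hN0
  have hMpos := hδ.trans_le hM0
  have hQ1 : 1 ≤ Q := by have : 0 ≤ D / δ := by positivity
                         linarith
  have hNM : |N - M| ≤ D := by
    have := abs_max_sub_max_le_abs ‖a‖ ‖b‖ δ
    exact this.trans (abs_norm_sub_norm_le a b)
  have hMQN : M / Q ≤ N := by
    rw [div_le_iff₀ (by linarith)]
    have : M ≤ N + D := by have := (abs_le.1 hNM).1; linarith
    have h2 : D ≤ N * (D / δ) := by
      rw [mul_div_assoc', le_div_iff₀ hδ]; nlinarith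
    rw [hQ]; linarith
  have hMQM : M / Q ≤ M := div_le_self hMpos.le hQ1
  have hMQ : 0 < M / Q := by positivity
  have e1 : regKernel d s δ a - regKernel d s δ b =
      N ^ (-(s + 1)) • (a - b) + (N ^ (-(s + 1)) - M ^ (-(s + 1))) • b := by
    rw [regKernel, regKernel, ← hN, ← hM, Real.rpow_neg hNpos.le, Real.rpow_neg hMpos.le]
    module
  have h1 : N ^ (-(s + 1)) ≤ (M / Q) ^ (-(s + 1)) :=
    Real.rpow_le_rpow_of_nonpos hMQ hMQN (by linarith)
  have h2 := abs_rpow_neg_sub_rpow_neg_le (p := s + 1) (by linarith) hMQ hMQN hMQM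
  have e2 : (M / Q) ^ (-(s + 1)) = M ^ (-(s + 1)) * Q ^ (s + 1) := by
    rw [Real.div_rpow hMpos.le (by linarith), Real.rpow_neg (by linarith : 0 ≤ Q), div_inv_eq_mul]
  have e3 : (M / Q) ^ (-(s + 1) - 1) * M = M ^ (-(s + 1)) * Q ^ (s + 2) := by
    have e4 : Q ^ (s + 2) = Q ^ (s + 1) * Q := by
      rw [show s + 2 = s + 1 + 1 by ring, Real.rpow_add_one (by linarith : Q ≠ 0)]
    rw [Real.rpow_sub_one hMQ.ne', e2, e4, div_div_eq_mul_div, div_mul_cancel₀ _ hMpos.ne',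
      mul_assoc]
  have h3 : Q ^ (s + 1) ≤ Q ^ (s + 2) := Real.rpow_le_rpow_of_exponent_le hQ1 (by linarith)
  calc _ ≤ N ^ (-(s + 1)) * D + |N ^ (-(s + 1)) - M ^ (-(s + 1))| * ‖b‖ := by
        rw [e1]
        refine (norm_add_le _ _).trans ?_
        rw [norm_smul, norm_smul, Real.norm_of_nonneg (by positivity), Real.norm_eq_abs]
    _ ≤ (M / Q) ^ (-(s + 1)) * D + (s + 1) * (M / Q) ^ (-(s + 1) - 1) * D * M := by
        gcongr
        · exact h2.trans (by gcongr)
        · exact le_max_left _ _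
    _ = D * (M ^ (-(s + 1)) * Q ^ (s + 1)) + (s + 1) * D * (M ^ (-(s + 1)) * Q ^ (s + 2)) := by
        rw [← e3, e2]; ring
    _ ≤ D * (M ^ (-(s + 1)) * Q ^ (s + 2)) + (s + 1) * D * (M ^ (-(s + 1)) * Q ^ (s + 2)) := by
        gcongr
    _ = _ := by ring

lemma exists_lipschitzWith_regKernel (hs : 0 < s) (hδ : 0 < δ) :
    ∃ C, LipschitzWith C (regKernel d s δ) := by
  refine ⟨Real.toNNReal ((s + 2) * 2 ^ (s + 2) * δ ^ (-(s + 1)) + 2 * δ ^ (-(s + 1))),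
    LipschitzWith.of_dist_le' fun a b => ?_⟩
  rw [dist_eq_norm, dist_eq_norm]
  rcases le_total ‖a - b‖ δ with h | h
  · refine (norm_regKernel_sub_le hs hδ a b).trans ?_
    have h1 : (1 + ‖a - b‖ / δ) ^ (s + 2) ≤ 2 ^ (s + 2) := by
      refine Real.rpow_le_rpow (by positivity) ?_ (by linarith)
      have := (div_le_one hδ).2 h
      linarith
    have h2 : max ‖b‖ δ ^ (-(s + 1)) ≤ δ ^ (-(s + 1)) :=
      Real.rpow_le_rpow_of_nonpos hδ (le_max_right _ _) (by linarith)
    calc _ ≤ (s + 2) * 2 ^ (s + 2) * ‖a - b‖ * δ ^ (-(s + 1)) := by gcongr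
      _ ≤ (s + 2) * 2 ^ (s + 2) * ‖a - b‖ * δ ^ (-(s + 1)) +
          2 * δ ^ (-(s + 1)) * ‖a - b‖ := le_add_of_nonneg_right (by positivity)
      _ = _ := by ring
  · have h1 : δ ^ (-s) = δ ^ (-(s + 1)) * δ := by
      rw [← Real.rpow_add_one hδ.ne']; ring_nf
    have h2 := norm_regKernel_le hs hδ a
    have h3 := norm_regKernel_le hs hδ b
    calc _ ≤ 2 * (δ ^ (-(s + 1)) * δ) := by
          have := norm_sub_le (regKernel d s δ a) (regKernel d s δ b)
          linarith
      _ ≤ 2 * (δ ^ (-(s + 1)) * ‖a - b‖) := by gcongr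
      _ ≤ 2 * (δ ^ (-(s + 1)) * ‖a - b‖) + (s + 2) * 2 ^ (s + 2) * ‖a - b‖ * δ ^ (-(s + 1)) :=
          le_add_of_nonneg_right (by positivity)
      _ = _ := by ring

lemma continuous_regKernel (hs : 0 < s) (hδ : 0 < δ) : Continuous (regKernel d s δ) :=
  let ⟨_, h⟩ := exists_lipschitzWith_regKernel hs hδ
  h.continuous

lemma measurable_rieszKernel : Measurable (rieszKernel d s) := by
  unfold rieszKernel
  fun_prop

/-- The divergence of `regKernel`. -/
noncomputable def regDiv (d : ℕ) (s δ : ℝ) (x : EuclideanSpace ℝ (Fin d)) : ℝ :=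
  if ‖x‖ < δ then d * (δ ^ (s + 1))⁻¹ else (d - (s + 1)) * (‖x‖ ^ (s + 1))⁻¹

lemma regDiv_nonneg (hs : s ≤ (d : ℝ) - 1) (hδ : 0 < δ) (x : EuclideanSpace ℝ (Fin d)) :
    0 ≤ regDiv d s δ x := by
  unfold regDiv
  split_ifs
  · positivity
  · exact mul_nonneg (by linarith) (by positivity)

/-- Inside the sphere of radius `δ` the kernel is linear; outside it is the Riesz kernel, whose
divergence is `(d - s - 1) |x|^(-s-1)`. Both are nonnegative exactly because `s ≤ d - 1`. -/
lemma sum_lineDeriv_regKernel (hδ : 0 < δ) {x : EuclideanSpace ℝ (Fin d)} (hx : ‖x‖ ≠ δ) :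
    ∑ i, lineDeriv ℝ (fun y => regKernel d s δ y i) x (EuclideanSpace.single i 1) =
      regDiv d s δ x := by
  rcases hx.lt_or_gt with h | h
  · have key : ∀ i, lineDeriv ℝ (fun y => regKernel d s δ y i) x (EuclideanSpace.single i 1) =
        (δ ^ (s + 1))⁻¹ := by
      intro i
      have h1 : (fun y => regKernel d s δ y i) =ᶠ[𝓝 x]
          fun y => (δ ^ (s + 1))⁻¹ * EuclideanSpace.proj (𝕜 := ℝ) i y := by
        filter_upwards [(isOpen_lt continuous_norm continuous_const).mem_nhds h] with y hy
        have hy' : ‖y‖ < δ := hy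
        simp [regKernel, max_eq_right hy'.le]
      have h2 : HasFDerivAt (fun y : EuclideanSpace ℝ (Fin d) => (δ ^ (s + 1))⁻¹ *
          EuclideanSpace.proj (𝕜 := ℝ) i y) ((δ ^ (s + 1))⁻¹ • EuclideanSpace.proj (𝕜 := ℝ) i) x :=
        (EuclideanSpace.proj (𝕜 := ℝ) i).hasFDerivAt.const_mul _
      rw [((h2.congr_of_eventuallyEq h1).hasLineDerivAt _).lineDeriv]
      simp
    rw [Finset.sum_congr rfl fun i _ => key i, regDiv, if_pos h]
    simp
  · have hx0 : 0 < ‖x‖ := hδ.trans h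
    have key : ∀ i, lineDeriv ℝ (fun y => regKernel d s δ y i) x (EuclideanSpace.single i 1) =
        (‖x‖ ^ (s + 1))⁻¹ - (s + 1) * (‖x‖ ^ (s + 1))⁻¹ / ‖x‖ ^ 2 * (x i * x i) := by
      intro i
      have h1 : (fun y => regKernel d s δ y i) =ᶠ[𝓝 x]
          fun y => (‖y‖ ^ 2) ^ (-(s + 1) / 2) * EuclideanSpace.proj (𝕜 := ℝ) i y := by
        filter_upwards [(isOpen_lt continuous_const continuous_norm).mem_nhds h] with y hy
        have hy' : δ < ‖y‖ := hy
        rw [← Real.rpow_natCast, ← Real.rpow_mul (norm_nonneg y)]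
        simp only [regKernel, max_eq_left hy'.le, ← Real.rpow_neg (norm_nonneg y)]
        have e : ((2 : ℕ) : ℝ) * (-(s + 1) / 2) = -(s + 1) := by push_cast; ring
        rw [e]
        simp
      have h3 : HasFDerivAt (fun y : EuclideanSpace ℝ (Fin d) => ‖y‖ ^ 2)
          (2 • innerSL ℝ x) x := (hasStrictFDerivAt_norm_sq x).hasFDerivAt
      have h2 := (h3.rpow_const (p := -(s + 1) / 2) (Or.inl (by positivity))).mul
        (EuclideanSpace.proj (𝕜 := ℝ) i).hasFDerivAt
      rw [((h2.congr_of_eventuallyEq h1).hasLineDerivAt _).lineDeriv]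
      have e1 : (‖x‖ ^ 2) ^ (-(s + 1) / 2) = (‖x‖ ^ (s + 1))⁻¹ := by
        rw [← Real.rpow_natCast, ← Real.rpow_mul (norm_nonneg x), ← Real.rpow_neg (norm_nonneg x)]
        congr 1; push_cast; ring
      have e2 : (‖x‖ ^ 2) ^ (-(s + 1) / 2 - 1) = (‖x‖ ^ (s + 1))⁻¹ / ‖x‖ ^ 2 := by
        rw [Real.rpow_sub_one (by positivity), e1]
      rw [e1, e2]
      simp [EuclideanSpace.inner_single_right]
      ring
    rw [Finset.sum_congr rfl fun i _ => key i, regDiv, if_neg h.not_gt, Finset.sum_sub_distrib,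
      ← Finset.mul_sum]
    have e3 : ∑ i, x i * x i = ‖x‖ ^ 2 := by
      rw [EuclideanSpace.norm_sq_eq]
      exact Finset.sum_congr rfl fun i _ => by rw [Real.norm_eq_abs, sq_abs, sq]
    rw [e3]
    simp
    field_simp

end Kernel

/-! ### Power integrals by dyadic annuli, and doubling points of a measure. -/

section Measure

variable {d : ℕ}

lemma measure_singleton_eq_zero_of_ball_le {μ : Measure (EuclideanSpace ℝ (Fin d))}
    {z : EuclideanSpace ℝ (Fin d)} {M b β : ℝ} (hβ : 0 < β) (hb : 0 < b)
    (h : ∀ t, 0 < t → t ≤ b → μ (Metric.ball z t) ≤ ENNReal.ofReal (M * t ^ β)) :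
    μ {z} = 0 := by
  have h1 : Tendsto (fun t : ℝ => ENNReal.ofReal (M * t ^ β)) (𝓝[>] 0) (𝓝 0) := by
    have : Tendsto (fun t : ℝ => ENNReal.ofReal (M * t ^ β)) (𝓝 0)
        (𝓝 (ENNReal.ofReal (M * (0 : ℝ) ^ β))) :=
      (ENNReal.continuous_ofReal.tendsto _).comp
        (((Real.continuousAt_rpow_const 0 β (Or.inr hβ.le)).tendsto).const_mul M)
    rw [Real.zero_rpow hβ.ne', mul_zero, ENNReal.ofReal_zero] at this
    exact this.mono_left nhdsWithin_le_nhds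
  refine le_antisymm (ge_of_tendsto h1 ?_) zero_le
  filter_upwards [Ioc_mem_nhdsGT hb] with t ht
  exact (measure_mono (by simpa using ht.1)).trans (h t ht.1 ht.2)

lemma rpow_neg_le_of_half_le {p q t : ℝ} (ht : 0 < t) (h1 : t / 2 ≤ q) (h2 : q ≤ t) :
    q ^ (-p) ≤ 2 ^ |p| * t ^ (-p) := by
  have hq : 0 < q := by linarith
  rcases le_total 0 p with hp | hp
  · refine (Real.rpow_le_rpow_of_nonpos (by linarith) h1 (by linarith)).trans ?_
    rw [abs_of_nonneg hp, Real.div_rpow ht.le (by norm_num), Real.rpow_neg (by norm_num : (0:ℝ) ≤ 2),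
      div_inv_eq_mul, mul_comm]
  · refine (Real.rpow_le_rpow hq.le h2 (by linarith)).trans ?_
    exact le_mul_of_one_le_left (by positivity) (Real.one_le_rpow (by norm_num) (abs_nonneg p))

/-- Summing over dyadic annuli shrinking to `z` gives a geometric series of ratio `2^(p-β) < 1`. The
sign of `p` is left free because the exponent `p = s - 1` occurs later. -/
lemma exists_lintegral_ball_rpow_le {p β : ℝ} (hβ : 0 < β) (hpβ : p < β) :
    ∃ C : ℝ, 0 < C ∧ ∀ (μ : Measure (EuclideanSpace ℝ (Fin d))) (z : EuclideanSpace ℝ (Fin d))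
      (M b : ℝ), 0 ≤ M → 0 < b →
      (∀ t, 0 < t → t ≤ b → μ (Metric.ball z t) ≤ ENNReal.ofReal (M * t ^ β)) →
      ∫⁻ x in Metric.ball z b, ENNReal.ofReal (‖x - z‖ ^ (-p)) ∂μ ≤
        ENNReal.ofReal (C * M * b ^ (β - p)) := by
  have hq1 : (2 : ℝ) ^ (-(β - p)) < 1 := Real.rpow_lt_one_of_one_lt_of_neg (by norm_num) (by linarith)
  have hq0 : (0 : ℝ) < 2 ^ (-(β - p)) := by positivity
  have hsub : 0 < 1 - (2 : ℝ) ^ (-(β - p)) := by linarith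
  refine ⟨2 ^ |p| * (1 - (2 : ℝ) ^ (-(β - p)))⁻¹, by positivity, fun μ z M b hM hb h => ?_⟩
  set S : ℕ → Set (EuclideanSpace ℝ (Fin d)) := fun j =>
    Metric.ball z (b / 2 ^ j) \ Metric.ball z (b / 2 ^ (j + 1)) with hS
  have hcover : Metric.ball z b ⊆ {z} ∪ ⋃ j, S j := by
    intro x hx
    rcases eq_or_ne x z with rfl | hxz
    · exact Or.inl rfl
    right
    have hd : 0 < dist x z := dist_pos.2 hxz
    have hlim : Tendsto (fun j : ℕ => b / 2 ^ j) atTop (𝓝 0) := by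
      have := (tendsto_pow_atTop_nhds_zero_of_lt_one (by norm_num : (0:ℝ) ≤ 1/2)
        (by norm_num : (1:ℝ)/2 < 1)).const_mul b
      simpa [div_eq_mul_inv] using this
    have hex : ∃ j : ℕ, b / 2 ^ j ≤ dist x z :=
      ((hlim.eventually (gt_mem_nhds hd)).exists).imp fun j hj => hj.le
    classical
    have hfind := Nat.find_spec hex
    obtain ⟨j, hj⟩ : ∃ j, Nat.find hex = j + 1 := by
      refine Nat.exists_eq_succ_of_ne_zero fun h0 => ?_
      rw [h0] at hfind
      simp only [pow_zero, div_one] at hfind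
      exact absurd (Metric.mem_ball.1 hx) (not_lt.2 hfind)
    have hmin := Nat.find_min hex (m := j) (by omega)
    rw [hj] at hfind
    exact Set.mem_iUnion.2 ⟨j, by simpa using hmin, by simpa using hfind⟩
  have hann : ∀ j, ∫⁻ x in S j, ENNReal.ofReal (‖x - z‖ ^ (-p)) ∂μ ≤
      ENNReal.ofReal (2 ^ |p| * M * b ^ (β - p) * (2 ^ (-(β - p))) ^ j) := by
    intro j
    have ht : 0 < b / 2 ^ j := by positivity
    calc ∫⁻ x in S j, ENNReal.ofReal (‖x - z‖ ^ (-p)) ∂μ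
        ≤ ∫⁻ x in S j, ENNReal.ofReal (2 ^ |p| * (b / 2 ^ j) ^ (-p)) ∂μ := by
          refine setLIntegral_mono' (measurableSet_ball.diff measurableSet_ball) fun x hx => ?_
          refine ENNReal.ofReal_le_ofReal (rpow_neg_le_of_half_le ht ?_ ?_)
          · have := hx.2
            rw [Metric.mem_ball, not_lt, dist_eq_norm] at this
            rw [div_div, ← pow_succ]; exact this
          · have := hx.1
            rw [Metric.mem_ball, dist_eq_norm] at this
            exact this.le
      _ ≤ ENNReal.ofReal (2 ^ |p| * (b / 2 ^ j) ^ (-p)) *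
          ENNReal.ofReal (M * (b / 2 ^ j) ^ β) := by
          rw [setLIntegral_const]
          gcongr
          refine (measure_mono Set.sdiff_subset).trans (h _ ht (div_le_self hb.le ?_))
          exact one_le_pow₀ (by norm_num)
      _ = _ := by
          rw [← ENNReal.ofReal_mul (by positivity)]
          congr 1
          have e1 : (b / 2 ^ j) ^ (-p) * (b / 2 ^ j) ^ β = (b / 2 ^ j) ^ (β - p) := by
            rw [← Real.rpow_add ht]; congr 1; ring
          have e2 : (b / 2 ^ j) ^ (β - p) = b ^ (β - p) * (2 ^ (-(β - p))) ^ j := by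
            rw [Real.div_rpow hb.le (by positivity), ← Real.rpow_natCast, ← Real.rpow_natCast,
              ← Real.rpow_mul (by norm_num), ← Real.rpow_mul (by norm_num), div_eq_mul_inv,
              ← Real.rpow_neg (by norm_num)]
            congr 2; ring
          calc _ = 2 ^ |p| * M * ((b / 2 ^ j) ^ (-p) * (b / 2 ^ j) ^ β) := by ring
            _ = _ := by rw [e1, e2]; ring
  calc _ ≤ ∫⁻ x in {z} ∪ ⋃ j, S j, ENNReal.ofReal (‖x - z‖ ^ (-p)) ∂μ :=
        lintegral_mono_set hcover
    _ ≤ ∫⁻ x in {z}, ENNReal.ofReal (‖x - z‖ ^ (-p)) ∂μ +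
        ∫⁻ x in ⋃ j, S j, ENNReal.ofReal (‖x - z‖ ^ (-p)) ∂μ := lintegral_union_le _ _ _
    _ = ∫⁻ x in ⋃ j, S j, ENNReal.ofReal (‖x - z‖ ^ (-p)) ∂μ := by
        rw [setLIntegral_measure_zero _ _ (measure_singleton_eq_zero_of_ball_le hβ hb h), zero_add]
    _ ≤ ∑' j, ∫⁻ x in S j, ENNReal.ofReal (‖x - z‖ ^ (-p)) ∂μ := lintegral_iUnion_le _ _
    _ ≤ ∑' j, ENNReal.ofReal (2 ^ |p| * M * b ^ (β - p) * (2 ^ (-(β - p))) ^ j) :=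
        ENNReal.tsum_le_tsum hann
    _ = _ := by
        rw [← ENNReal.ofReal_tsum_of_nonneg (fun j => by positivity)
          ((summable_geometric_of_lt_one hq0.le hq1).mul_left _), tsum_mul_left,
          tsum_geometric_of_lt_one hq0.le hq1]
        congr 1; ring

lemma exists_lintegral_compl_ball_rpow_le {p β : ℝ} (hp : 0 ≤ p) (hpβ : β < p) :
    ∃ C : ℝ, 0 < C ∧ ∀ (μ : Measure (EuclideanSpace ℝ (Fin d))) (z : EuclideanSpace ℝ (Fin d))
      (M b : ℝ), 0 ≤ M → 0 < b →
      (∀ t, b ≤ t → μ (Metric.ball z t) ≤ ENNReal.ofReal (M * t ^ β)) →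
      ∫⁻ x in (Metric.ball z b)ᶜ, ENNReal.ofReal (‖x - z‖ ^ (-p)) ∂μ ≤
        ENNReal.ofReal (C * M * b ^ (β - p)) := by
  have hq1 : (2 : ℝ) ^ (β - p) < 1 := Real.rpow_lt_one_of_one_lt_of_neg (by norm_num) (by linarith)
  have hq0 : (0 : ℝ) < 2 ^ (β - p) := by positivity
  have hsub : 0 < 1 - (2 : ℝ) ^ (β - p) := by linarith
  refine ⟨2 ^ β * (1 - (2 : ℝ) ^ (β - p))⁻¹, by positivity, fun μ z M b hM hb h => ?_⟩
  set S : ℕ → Set (EuclideanSpace ℝ (Fin d)) := fun j =>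
    Metric.ball z (b * 2 ^ (j + 1)) \ Metric.ball z (b * 2 ^ j) with hS
  have hcover : (Metric.ball z b)ᶜ ⊆ ⋃ j, S j := by
    intro x hx
    have hlim : Tendsto (fun j : ℕ => b * 2 ^ j) atTop atTop :=
      (tendsto_pow_atTop_atTop_of_one_lt (by norm_num : (1:ℝ) < 2)).const_mul_atTop hb
    have hex : ∃ j : ℕ, dist x z < b * 2 ^ j := (hlim.eventually (eventually_gt_atTop _)).exists
    classical
    have hfind := Nat.find_spec hex
    obtain ⟨j, hj⟩ : ∃ j, Nat.find hex = j + 1 := by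
      refine Nat.exists_eq_succ_of_ne_zero fun h0 => ?_
      rw [h0] at hfind
      simp only [pow_zero, mul_one] at hfind
      exact hx hfind
    have hmin := Nat.find_min hex (m := j) (by omega)
    rw [hj] at hfind
    exact Set.mem_iUnion.2 ⟨j, by simpa using hfind, by simpa using hmin⟩
  have hann : ∀ j, ∫⁻ x in S j, ENNReal.ofReal (‖x - z‖ ^ (-p)) ∂μ ≤
      ENNReal.ofReal (2 ^ β * M * b ^ (β - p) * (2 ^ (β - p)) ^ j) := by
    intro j
    have ht : 0 < b * 2 ^ j := by positivity
    calc ∫⁻ x in S j, ENNReal.ofReal (‖x - z‖ ^ (-p)) ∂μ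
        ≤ ∫⁻ x in S j, ENNReal.ofReal ((b * 2 ^ j) ^ (-p)) ∂μ := by
          refine setLIntegral_mono' (measurableSet_ball.diff measurableSet_ball) fun x hx => ?_
          refine ENNReal.ofReal_le_ofReal (Real.rpow_le_rpow_of_nonpos ht ?_ (by linarith))
          have := hx.2
          rwa [Metric.mem_ball, not_lt, dist_eq_norm] at this
      _ ≤ ENNReal.ofReal ((b * 2 ^ j) ^ (-p)) *
          ENNReal.ofReal (M * (b * 2 ^ (j + 1)) ^ β) := by
          rw [setLIntegral_const]
          gcongr
          refine (measure_mono Set.sdiff_subset).trans (h _ (le_mul_of_one_le_right hb.le ?_))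
          exact one_le_pow₀ (by norm_num)
      _ = _ := by
          rw [← ENNReal.ofReal_mul (by positivity)]
          congr 1
          have e0 : (b * 2 ^ (j + 1)) ^ β = (b * 2 ^ j) ^ β * 2 ^ β := by
            rw [← Real.mul_rpow ht.le (by norm_num), pow_succ, mul_assoc]
          have e1 : (b * 2 ^ j) ^ (-p) * (b * 2 ^ j) ^ β = (b * 2 ^ j) ^ (β - p) := by
            rw [← Real.rpow_add ht]; congr 1; ring
          have e2 : (b * 2 ^ j) ^ (β - p) = b ^ (β - p) * (2 ^ (β - p)) ^ j := by
            rw [Real.mul_rpow hb.le (by positivity), ← Real.rpow_natCast, ← Real.rpow_natCast,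
              ← Real.rpow_mul (by norm_num), ← Real.rpow_mul (by norm_num)]
            congr 2; ring
          calc _ = 2 ^ β * M * ((b * 2 ^ j) ^ (-p) * (b * 2 ^ j) ^ β) := by rw [e0]; ring
            _ = _ := by rw [e1, e2]; ring
  calc _ ≤ ∫⁻ x in ⋃ j, S j, ENNReal.ofReal (‖x - z‖ ^ (-p)) ∂μ := lintegral_mono_set hcover
    _ ≤ ∑' j, ∫⁻ x in S j, ENNReal.ofReal (‖x - z‖ ^ (-p)) ∂μ := lintegral_iUnion_le _ _
    _ ≤ ∑' j, ENNReal.ofReal (2 ^ β * M * b ^ (β - p) * (2 ^ (β - p)) ^ j) :=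
        ENNReal.tsum_le_tsum hann
    _ = _ := by
        rw [← ENNReal.ofReal_tsum_of_nonneg (fun j => by positivity)
          ((summable_geometric_of_lt_one hq0.le hq1).mul_left _), tsum_mul_left,
          tsum_geometric_of_lt_one hq0.le hq1]
        congr 1; ring

lemma lintegral_measure_inter_ball (μ : Measure (EuclideanSpace ℝ (Fin d))) [SFinite μ]
    {A : Set (EuclideanSpace ℝ (Fin d))} (hA : MeasurableSet A) (t : ℝ) :
    ∫⁻ x, μ (A ∩ Metric.ball x t) = volume (Metric.ball (0 : EuclideanSpace ℝ (Fin d)) t) * μ A := by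
  set P : Set (EuclideanSpace ℝ (Fin d) × EuclideanSpace ℝ (Fin d)) :=
    {p | p.2 ∈ A ∧ dist p.2 p.1 < t} with hP
  have hPm : MeasurableSet P :=
    (measurable_snd hA).inter (measurableSet_lt (measurable_snd.dist measurable_fst) measurable_const)
  have h1 : (volume.prod μ) P = ∫⁻ x, μ (A ∩ Metric.ball x t) := by
    rw [Measure.prod_apply hPm]; rfl
  have h2 : (volume.prod μ) P =
      ∫⁻ y, A.indicator (fun _ => volume (Metric.ball (0 : EuclideanSpace ℝ (Fin d)) t)) y ∂μ := by
    rw [Measure.prod_apply_symm hPm]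
    refine lintegral_congr fun y => ?_
    by_cases hy : y ∈ A
    · rw [Set.indicator_of_mem hy, ← Measure.addHaar_ball_center volume y t]
      congr 1
      ext x
      simp [hP, hy, dist_comm]
    · rw [Set.indicator_of_notMem hy]
      convert measure_empty (μ := (volume : Measure (EuclideanSpace ℝ (Fin d))))
      ext x
      simp [hP, hy]
  rw [← h1, h2, lintegral_indicator hA, setLIntegral_const]

/-- Fast decay at every scale cannot hold at all support points in the ball: mass of order
`4^(-(d+1)j)` at radius `h / 4^j` is too little for the roughly `4^(dj)` balls needed to cover a
`d`-dimensional region. So at some point the decay stops, and the first scale where it stops is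
doubling while all earlier scales still decay. -/
lemma exists_doubling_point (μ : Measure (EuclideanSpace ℝ (Fin d))) [IsLocallyFiniteMeasure μ]
    {x : EuclideanSpace ℝ (Fin d)} {h : ℝ} (hh : 0 < h) (hpos : 0 < μ (Metric.ball x h)) :
    ∃ z ∈ Metric.ball x h, ∃ k : ℕ, 0 < μ (Metric.ball z (h / 4 ^ (k + 1))) ∧
      μ (Metric.ball z (h / 4 ^ k)) ≤ 4 ^ (d + 1) * μ (Metric.ball z (h / 4 ^ (k + 1))) ∧
      ∀ j ≤ k, (4 ^ (d + 1)) ^ j * μ (Metric.ball z (h / 4 ^ j)) ≤ μ (Metric.ball z h) := by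
  by_contra! hcon
  set A := Metric.ball x h ∩ μ.support with hA
  have hAm : MeasurableSet A := measurableSet_ball.inter Measure.isClosed_support.measurableSet
  have hμA : μ A = μ (Metric.ball x h) := by
    refine measure_inter_conull ?_
    exact Measure.measure_compl_support
  -- If no point and scale work, the decay persists to every scale: a first failure at `j + 1` would
  -- make scale `j` doubling, with all scales up to `j` decaying.
  have hpt : ∀ z ∈ A, ∀ j, (4 ^ (d + 1)) ^ j * μ (Metric.ball z (h / 4 ^ j)) ≤
      μ (Metric.ball z h) := by
    intro z hz j
    induction j using Nat.strong_induction_on with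
    | _ j ih =>
      rcases j with _ | j
      · simp
      by_contra hlt
      obtain ⟨i, hi, hi2⟩ := hcon z hz.1 j
        (Measure.mem_support_iff_forall z |>.1 hz.2 _ (Metric.ball_mem_nhds z (by positivity)))
        (by
          by_contra hlt2
          refine hlt ?_
          rw [pow_succ, mul_assoc]
          exact (mul_le_mul_right (not_le.1 hlt2).le _).trans (ih j (by omega)))
      exact absurd (ih i (by omega)) (not_le.2 hi2)
  have hfin : μ (Metric.ball x (2 * h)) < ∞ := measure_ball_lt_top
  -- Averaging `μ(A ∩ B(y, t))` over `y` replaces a covering argument. The volume of the small ball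
  -- loses only `4^(-dj)` against the decay `4^(-(d+1)j)`, so a factor `4^j` remains, which is
  -- absurd for large `j`.
  have key : ∀ j : ℕ, 4 ^ j * (volume (Metric.ball (0 : EuclideanSpace ℝ (Fin d)) (h / 2)) * μ A) ≤
      μ (Metric.ball x (2 * h)) * volume (Metric.ball x (2 * h)) := by
    intro j
    have e1 : (4 ^ d) ^ j * volume (Metric.ball (0 : EuclideanSpace ℝ (Fin d)) (h / 4 ^ j / 2)) =
        volume (Metric.ball (0 : EuclideanSpace ℝ (Fin d)) (h / 2)) := by
      rw [Measure.addHaar_ball_of_pos _ _ (show 0 < h / 4 ^ j / 2 by positivity),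
        Measure.addHaar_ball_of_pos _ _ (show 0 < h / 2 by positivity), ← mul_assoc]
      congr 1
      have : ((4 : ℝ≥0∞) ^ d) ^ j = ENNReal.ofReal ((4 ^ d) ^ j) := by
        rw [ENNReal.ofReal_pow (by positivity), ENNReal.ofReal_pow (by positivity)]; norm_num
      rw [this, ← ENNReal.ofReal_mul (by positivity), finrank_euclideanSpace_fin, ← pow_mul,
        mul_comm d j, pow_mul, ← mul_pow]
      congr 2
      field_simp
    have e2 := lintegral_measure_inter_ball μ hAm (h / 4 ^ j / 2)
    calc 4 ^ j * (volume (Metric.ball (0 : EuclideanSpace ℝ (Fin d)) (h / 2)) * μ A)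
        = (4 ^ (d + 1)) ^ j * (volume (Metric.ball (0 : EuclideanSpace ℝ (Fin d)) (h / 4 ^ j / 2))
          * μ A) := by
          rw [← e1, pow_succ, mul_pow]; ring
      _ = ∫⁻ y, (4 ^ (d + 1)) ^ j * μ (A ∩ Metric.ball y (h / 4 ^ j / 2)) := by
          rw [← e2, lintegral_const_mul' _ _ (by finiteness)]
      _ ≤ ∫⁻ y, (Metric.ball x (2 * h)).indicator (fun _ => μ (Metric.ball x (2 * h))) y := by
          refine lintegral_mono fun y => ?_
          have ht : h / 4 ^ j ≤ h := div_le_self hh.le (one_le_pow₀ (by norm_num))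
          rcases (A ∩ Metric.ball y (h / 4 ^ j / 2)).eq_empty_or_nonempty with he | ⟨z, hz⟩
          · simp [he]
          have hzx := Metric.mem_ball.1 hz.1.1
          have hzy := Metric.mem_ball.1 hz.2
          have hy : y ∈ Metric.ball x (2 * h) := by
            rw [Metric.mem_ball]
            have := dist_triangle_left y x z
            linarith
          rw [Set.indicator_of_mem hy]
          calc _ ≤ (4 ^ (d + 1)) ^ j * μ (Metric.ball z (h / 4 ^ j)) := by
                gcongr
                refine Set.inter_subset_right.trans (Metric.ball_subset_ball' ?_)
                rw [dist_comm]; linarith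
            _ ≤ μ (Metric.ball z h) := hpt z hz.1 j
            _ ≤ _ := measure_mono (Metric.ball_subset_ball' (by linarith))
      _ = _ := by
          rw [lintegral_indicator measurableSet_ball, setLIntegral_const]
  have hc0 : volume (Metric.ball (0 : EuclideanSpace ℝ (Fin d)) (h / 2)) * μ A ≠ 0 := by
    rw [hμA]
    exact mul_ne_zero (Metric.measure_ball_pos _ _ (by positivity)).ne' hpos.ne'
  obtain ⟨n, hn⟩ := ENNReal.exists_nat_mul_gt hc0
    (ENNReal.mul_lt_top hfin (measure_ball_lt_top (μ := volume) (x := x) (r := 2 * h))).ne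
  refine absurd (hn.trans_le ?_) (not_lt.2 (key n))
  gcongr
  exact_mod_cast (Nat.lt_pow_self (by norm_num : 1 < 4)).le

end Measure

/-! ### The regularised potential and its oscillation at scale `δ`. -/

section Potential

variable {d : ℕ} {s δ Λ : ℝ} {μ : Measure (EuclideanSpace ℝ (Fin d))}

/-- The ball of radius `δ` contributes at most `δ^(-s-1) · Λ δ^s`; outside it the annuli sum because
`s + 1` exceeds the growth exponent `s`. -/
lemma exists_integral_max_rpow_le (d : ℕ) (hs : 0 < s) :
    ∃ C : ℝ, 0 < C ∧ ∀ (Λ : ℝ) (μ : Measure (EuclideanSpace ℝ (Fin d))), 0 ≤ Λ → IsNice s Λ μ →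
      ∀ (x : EuclideanSpace ℝ (Fin d)) (δ : ℝ), 0 < δ →
        Integrable (fun y => max ‖y - x‖ δ ^ (-(s + 1))) μ ∧
        ∫ y, max ‖y - x‖ δ ^ (-(s + 1)) ∂μ ≤ C * Λ / δ := by
  obtain ⟨C, hC, hB⟩ := exists_lintegral_compl_ball_rpow_le (d := d) (p := s + 1) (β := s)
    (by linarith) (by linarith)
  refine ⟨1 + C, by positivity, fun Λ μ hΛ hμ x δ hδ => ?_⟩
  have hnn : ∀ y : EuclideanSpace ℝ (Fin d), 0 ≤ max ‖y - x‖ δ ^ (-(s + 1)) := fun y =>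
    Real.rpow_nonneg (hδ.le.trans (le_max_right _ _)) _
  have hmeas : Measurable fun y : EuclideanSpace ℝ (Fin d) => max ‖y - x‖ δ ^ (-(s + 1)) := by
    fun_prop
  have h1 : ∫⁻ y in Metric.ball x δ, ENNReal.ofReal (max ‖y - x‖ δ ^ (-(s + 1))) ∂μ ≤
      ENNReal.ofReal (Λ / δ) := by
    calc _ ≤ ∫⁻ y in Metric.ball x δ, ENNReal.ofReal (δ ^ (-(s + 1))) ∂μ := by
          refine lintegral_mono fun y => ENNReal.ofReal_le_ofReal ?_
          exact Real.rpow_le_rpow_of_nonpos hδ (le_max_right _ _) (by linarith)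
      _ ≤ ENNReal.ofReal (δ ^ (-(s + 1))) * ENNReal.ofReal (Λ * δ ^ s) := by
          rw [setLIntegral_const]
          gcongr
          exact hμ x δ hδ
      _ = _ := by
          rw [← ENNReal.ofReal_mul (by positivity)]
          congr 1
          rw [Real.rpow_neg hδ.le, Real.rpow_add_one hδ.ne']
          field_simp
  have h2 : ∫⁻ y in (Metric.ball x δ)ᶜ, ENNReal.ofReal (max ‖y - x‖ δ ^ (-(s + 1))) ∂μ ≤
      ENNReal.ofReal (C * Λ / δ) := by
    have e : C * Λ / δ = C * Λ * δ ^ (s - (s + 1)) := by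
      rw [show s - (s + 1) = -1 by ring, Real.rpow_neg_one, div_eq_mul_inv]
    rw [e]
    refine le_trans (setLIntegral_mono' measurableSet_ball.compl fun y hy => ?_)
      (hB μ x Λ δ hΛ hδ fun t ht => hμ x t (hδ.trans_le ht))
    rw [Set.mem_compl_iff, Metric.mem_ball, not_lt, dist_eq_norm] at hy
    rw [max_eq_left hy]
  have h3 : ∫⁻ y, ENNReal.ofReal (max ‖y - x‖ δ ^ (-(s + 1))) ∂μ ≤
      ENNReal.ofReal ((1 + C) * Λ / δ) := by
    rw [← lintegral_add_compl _ (measurableSet_ball (x := x) (ε := δ))]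
    refine (add_le_add h1 h2).trans ?_
    rw [← ENNReal.ofReal_add (by positivity) (by positivity)]
    exact ENNReal.ofReal_le_ofReal (le_of_eq (by ring))
  refine ⟨⟨hmeas.aestronglyMeasurable, ?_⟩, ?_⟩
  · rw [hasFiniteIntegral_iff_ofReal (Eventually.of_forall hnn)]
    exact h3.trans_lt ENNReal.ofReal_lt_top
  · rw [integral_eq_lintegral_of_nonneg_ae (Eventually.of_forall hnn) hmeas.aestronglyMeasurable]
    exact ENNReal.toReal_le_of_le_ofReal (by positivity) h3

/-- The regularised potential of `μ` with pole `u`, normalised to vanish at `u = x₀`. -/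
noncomputable def potDiff {d : ℕ} (s δ : ℝ) (μ : Measure (EuclideanSpace ℝ (Fin d)))
    (x₀ u : EuclideanSpace ℝ (Fin d)) : EuclideanSpace ℝ (Fin d) :=
  ∫ y, (regKernel d s δ (y - u) - regKernel d s δ (y - x₀)) ∂μ

lemma norm_regKernel_sub_sub_le (hs : 0 < s) (hδ : 0 < δ) (y u x : EuclideanSpace ℝ (Fin d)) :
    ‖regKernel d s δ (y - u) - regKernel d s δ (y - x)‖ ≤
      (s + 2) * (1 + ‖u - x‖ / δ) ^ (s + 2) * ‖u - x‖ * max ‖y - x‖ δ ^ (-(s + 1)) := by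
  have := norm_regKernel_sub_le hs hδ (y - u) (y - x)
  rwa [show y - u - (y - x) = -(u - x) by abel, norm_neg] at this

lemma integrable_regKernel_sub_sub (hs : 0 < s) (hδ : 0 < δ) (hΛ : 0 ≤ Λ) (hμ : IsNice s Λ μ)
    (u x : EuclideanSpace ℝ (Fin d)) :
    Integrable (fun y => regKernel d s δ (y - u) - regKernel d s δ (y - x)) μ := by
  obtain ⟨C, -, hC⟩ := exists_integral_max_rpow_le d hs
  have hc := continuous_regKernel (d := d) hs hδ
  refine Integrable.mono' (((hC Λ μ hΛ hμ x δ hδ).1).const_mul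
    ((s + 2) * (1 + ‖u - x‖ / δ) ^ (s + 2) * ‖u - x‖)) ?_
    (Eventually.of_forall fun y => norm_regKernel_sub_sub_le hs hδ y u x)
  exact Continuous.aestronglyMeasurable (by fun_prop)

lemma exists_norm_potDiff_sub_le (d : ℕ) (hs : 0 < s) :
    ∃ C : ℝ, 0 < C ∧ ∀ (Λ : ℝ) (μ : Measure (EuclideanSpace ℝ (Fin d))), 0 ≤ Λ → IsNice s Λ μ →
      ∀ (x₀ u v : EuclideanSpace ℝ (Fin d)) (δ : ℝ), 0 < δ → ‖u - v‖ ≤ δ →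
        ‖potDiff s δ μ x₀ u - potDiff s δ μ x₀ v‖ ≤ C * Λ * ‖u - v‖ / δ := by
  obtain ⟨C, hC0, hC⟩ := exists_integral_max_rpow_le d hs
  refine ⟨(s + 2) * 2 ^ (s + 2) * C, by positivity, fun Λ μ hΛ hμ x₀ u v δ hδ huv => ?_⟩
  obtain ⟨hi, hle⟩ := hC Λ μ hΛ hμ v δ hδ
  rw [potDiff, potDiff, ← integral_sub (integrable_regKernel_sub_sub hs hδ hΛ hμ u x₀)
    (integrable_regKernel_sub_sub hs hδ hΛ hμ v x₀)]
  have hQ : (1 + ‖u - v‖ / δ) ^ (s + 2) ≤ 2 ^ (s + 2) := by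
    refine Real.rpow_le_rpow (by positivity) ?_ (by linarith)
    have := (div_le_one hδ).2 huv
    linarith
  calc _ ≤ ∫ y, (s + 2) * 2 ^ (s + 2) * ‖u - v‖ * max ‖y - v‖ δ ^ (-(s + 1)) ∂μ := by
        refine norm_integral_le_of_norm_le (hi.const_mul _) (Eventually.of_forall fun y => ?_)
        rw [sub_sub_sub_cancel_right]
        refine (norm_regKernel_sub_sub_le hs hδ y u v).trans ?_
        have : 0 ≤ max ‖y - v‖ δ ^ (-(s + 1)) :=
          Real.rpow_nonneg (hδ.le.trans (le_max_right _ _)) _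
        gcongr
    _ ≤ (s + 2) * 2 ^ (s + 2) * ‖u - v‖ * (C * Λ / δ) := by
        rw [integral_const_mul]
        gcongr
    _ = _ := by ring

lemma continuous_potDiff (hs : 0 < s) (hδ : 0 < δ) (hΛ : 0 ≤ Λ) (hμ : IsNice s Λ μ)
    (x₀ : EuclideanSpace ℝ (Fin d)) : Continuous (potDiff s δ μ x₀) := by
  obtain ⟨C, hC0, hC⟩ := exists_norm_potDiff_sub_le d hs
  refine continuous_iff_continuousAt.2 fun v => ?_
  rw [ContinuousAt, tendsto_iff_norm_sub_tendsto_zero]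
  have hlim : Tendsto (fun u : EuclideanSpace ℝ (Fin d) => C * Λ * ‖u - v‖ / δ) (𝓝 v) (𝓝 0) := by
    have : Continuous fun u : EuclideanSpace ℝ (Fin d) => C * Λ * ‖u - v‖ / δ := by fun_prop
    simpa using this.tendsto v
  refine squeeze_zero' (Eventually.of_forall fun u => norm_nonneg _) ?_ hlim
  filter_upwards [Metric.ball_mem_nhds v hδ] with u hu
  rw [Metric.mem_ball, dist_eq_norm] at hu
  exact hC Λ μ hΛ hμ x₀ u v δ hδ hu.le

end Potential

/-! ### Rewriting the reflectionless condition through the regularised potential. -/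

section Identity

variable {d : ℕ} {s δ Λ : ℝ} {μ : Measure (EuclideanSpace ℝ (Fin d))}
  {f ψ : EuclideanSpace ℝ (Fin d) → ℝ}

lemma IsLipZero.continuous (hf : IsLipZero f) : Continuous f := hf.1.choose_spec.continuous

lemma IsLipZero.integrable [IsLocallyFiniteMeasure μ] (hf : IsLipZero f) : Integrable f μ :=
  hf.continuous.integrable_of_hasCompactSupport hf.2

lemma IsLipZero.exists_abs_le (hf : IsLipZero f) : ∃ B, 0 ≤ B ∧ ∀ x, |f x| ≤ B := by
  obtain ⟨B, hB⟩ := hf.2.exists_bound_of_continuous hf.continuous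
  exact ⟨B, (norm_nonneg _).trans (hB 0), hB⟩

lemma exists_abs_antisym_le (hf : IsLipZero f) (hψ : IsLipZero ψ) :
    ∃ C : ℝ, 0 ≤ C ∧ ∀ x y, |antisym f ψ x y| ≤ C * ‖x - y‖ := by
  obtain ⟨⟨Cf, hCf⟩, -⟩ := id hf
  obtain ⟨⟨Cψ, hCψ⟩, -⟩ := id hψ
  obtain ⟨Bf, hBf0, hBf⟩ := hf.exists_abs_le
  obtain ⟨Bψ, hBψ0, hBψ⟩ := hψ.exists_abs_le
  refine ⟨1 / 2 * (Bf * Cψ + Bψ * Cf), by positivity, fun x y => ?_⟩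
  have h1 : |ψ x - ψ y| ≤ Cψ * ‖x - y‖ := by
    simpa [Real.dist_eq, dist_eq_norm] using hCψ.dist_le_mul x y
  have h2 : |f y - f x| ≤ Cf * ‖x - y‖ := by
    rw [abs_sub_comm]
    simpa [Real.dist_eq, dist_eq_norm] using hCf.dist_le_mul x y
  rw [antisym, abs_mul, show f y * ψ x - ψ y * f x = f y * (ψ x - ψ y) + ψ y * (f y - f x) by ring,
    abs_of_pos (by norm_num : (0 : ℝ) < 1 / 2), mul_assoc]
  gcongr
  calc _ ≤ |f y| * |ψ x - ψ y| + |ψ y| * |f y - f x| := by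
        rw [← abs_mul, ← abs_mul]; exact abs_add_le _ _
    _ ≤ Bf * (Cψ * ‖x - y‖) + Bψ * (Cf * ‖x - y‖) := by
        gcongr
        · exact hBf y
        · exact hBψ y
    _ = _ := by ring

lemma continuous_antisym (hf : Continuous f) (hψ : Continuous ψ) :
    Continuous fun p : EuclideanSpace ℝ (Fin d) × EuclideanSpace ℝ (Fin d) =>
      antisym f ψ p.1 p.2 := by
  unfold antisym
  fun_prop

/-- Antisymmetry gives a factor `|x - y|`, which turns `|x - y|^(-s)` into the locally integrable
`|x - y|^(1-s)` of a diffuse measure. -/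
lemma integrable_antisym_smul_rieszKernel [IsLocallyFiniteMeasure μ] (hs : 0 < s)
    (hdiff : IsDiffuse s μ) (hf : IsLipZero f) (hψ : IsLipZero ψ) :
    Integrable (fun p : EuclideanSpace ℝ (Fin d) × EuclideanSpace ℝ (Fin d) =>
      antisym f ψ p.1 p.2 • rieszKernel d s (p.1 - p.2)) (μ.prod μ) := by
  obtain ⟨C, hC0, hC⟩ := exists_abs_antisym_le hf hψ
  set S := tsupport f ∪ tsupport ψ with hS
  have hSc : IsCompact S := hf.2.isCompact.union hψ.2.isCompact
  have hzero : ∀ x ∉ S, f x = 0 ∧ ψ x = 0 := fun x hx =>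
    ⟨image_eq_zero_of_notMem_tsupport fun h => hx (Or.inl h),
      image_eq_zero_of_notMem_tsupport fun h => hx (Or.inr h)⟩
  refine ⟨?_, ?_⟩
  · refine (continuous_antisym hf.continuous hψ.continuous).aestronglyMeasurable.smul ?_
    exact (measurable_rieszKernel.comp (measurable_fst.sub measurable_snd)).aestronglyMeasurable
  · have hbound : ∀ p : EuclideanSpace ℝ (Fin d) × EuclideanSpace ℝ (Fin d),
        ‖antisym f ψ p.1 p.2 • rieszKernel d s (p.1 - p.2)‖ₑ ≤
          (S ×ˢ S).indicator (fun p => ENNReal.ofReal C * edist p.1 p.2 ^ (1 - s)) p := by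
      rintro ⟨x, y⟩
      by_cases hxy : (x, y) ∈ S ×ˢ S
      · rw [Set.indicator_of_mem hxy]
        rcases eq_or_ne x y with rfl | hne
        · simp [antisym, mul_comm]
        have hpos : 0 < ‖x - y‖ := norm_pos_iff.2 (sub_ne_zero.2 hne)
        rw [edist_dist, dist_eq_norm, ENNReal.ofReal_rpow_of_pos hpos, ← ENNReal.ofReal_mul hC0,
          ← ofReal_norm]
        refine ENNReal.ofReal_le_ofReal ?_
        rw [norm_smul, norm_rieszKernel hs, Real.norm_eq_abs, sub_eq_add_neg 1 s,
          Real.rpow_add hpos, Real.rpow_one, ← mul_assoc]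
        gcongr
        exact hC x y
      · have : antisym f ψ x y = 0 := by
          rw [Set.mem_prod, not_and_or] at hxy
          rcases hxy with h | h
          · simp [antisym, hzero _ h]
          · simp [antisym, hzero _ h]
        simp [this]
    refine (lintegral_mono hbound).trans_lt ?_
    have hSm : MeasurableSet (S ×ˢ S) := hSc.measurableSet.prod hSc.measurableSet
    rw [lintegral_indicator hSm, lintegral_const_mul' _ _ ENNReal.ofReal_ne_top]
    exact ENNReal.mul_lt_top ENNReal.ofReal_lt_top (hdiff _ (hSc.prod hSc))

lemma integrable_mul_smul_regKernel [IsLocallyFiniteMeasure μ] (hs : 0 < s) (hδ : 0 < δ)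
    (hf : IsLipZero f) (hψ : IsLipZero ψ) :
    Integrable (fun p : EuclideanSpace ℝ (Fin d) × EuclideanSpace ℝ (Fin d) =>
      (ψ p.1 * f p.2) • regKernel d s δ (p.1 - p.2)) (μ.prod μ) := by
  have hc := continuous_regKernel (d := d) hs hδ
  refine Integrable.smul_of_top_left (hψ.integrable.mul_prod hf.integrable) ?_
  exact memLp_top_of_bound (Continuous.aestronglyMeasurable (by fun_prop)) (δ ^ (-s))
    (Eventually.of_forall fun p => norm_regKernel_le hs hδ _)

lemma integrable_smul_regKernel_sub_sub {ν : Measure (EuclideanSpace ℝ (Fin d))} [SFinite ν]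
    [SFinite μ] (hs : 0 < s) (hδ : 0 < δ) (hΛ : 0 ≤ Λ) (hμ : IsNice s Λ μ) (hf : Integrable f ν)
    {x₀ : EuclideanSpace ℝ (Fin d)} {D : ℝ} (hD : ∀ y, f y ≠ 0 → ‖y - x₀‖ ≤ D) :
    Integrable (fun p : EuclideanSpace ℝ (Fin d) × EuclideanSpace ℝ (Fin d) =>
      f p.2 • (regKernel d s δ (p.1 - p.2) - regKernel d s δ (p.1 - x₀))) (μ.prod ν) := by
  obtain ⟨C, -, hC⟩ := exists_integral_max_rpow_le d hs
  have hc := continuous_regKernel (d := d) hs hδ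
  have hg := (hC Λ μ hΛ hμ x₀ δ hδ).1
  refine Integrable.mono' ((hg.mul_prod hf.norm).const_mul
    ((s + 2) * (1 + D / δ) ^ (s + 2) * D))
    (hf.aestronglyMeasurable.comp_snd.smul (Continuous.aestronglyMeasurable (by fun_prop)))
    (Eventually.of_forall fun p => ?_)
  by_cases hp : f p.2 = 0
  · simp [hp]
  have hpD : ‖p.2 - x₀‖ ≤ D := hD _ hp
  have hD0 := (norm_nonneg _).trans hpD
  have hg0 : 0 ≤ max ‖p.1 - x₀‖ δ ^ (-(s + 1)) :=
    Real.rpow_nonneg (hδ.le.trans (le_max_right _ _)) _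
  rw [norm_smul]
  calc _ ≤ ‖f p.2‖ * ((s + 2) * (1 + D / δ) ^ (s + 2) * D * max ‖p.1 - x₀‖ δ ^ (-(s + 1))) := by
        gcongr
        refine (norm_regKernel_sub_sub_le hs hδ p.1 p.2 x₀).trans ?_
        gcongr
    _ = _ := by ring

/-- The truncated kernel is bounded, so each half of the antisymmetrised integrand is integrable by
itself; since the kernel is odd, the halves agree after swapping the variables. -/
lemma pairing_regKernel [IsLocallyFiniteMeasure μ] (hs : 0 < s) (hδ : 0 < δ)
    (hf : IsLipZero f) (hψ : IsLipZero ψ) :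
    pairing (regKernel d s δ) μ f ψ = ∫ x, ψ x • ∫ y, f y • regKernel d s δ (x - y) ∂μ ∂μ := by
  set G : EuclideanSpace ℝ (Fin d) × EuclideanSpace ℝ (Fin d) → EuclideanSpace ℝ (Fin d) :=
    fun p => (ψ p.1 * f p.2) • regKernel d s δ (p.1 - p.2) with hG
  have hGi : Integrable G (μ.prod μ) := integrable_mul_smul_regKernel hs hδ hf hψ
  have e : ∀ p : EuclideanSpace ℝ (Fin d) × EuclideanSpace ℝ (Fin d),
      antisym f ψ p.1 p.2 • regKernel d s δ (p.1 - p.2) =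
        (1 / 2 : ℝ) • G p + (1 / 2 : ℝ) • G p.swap := by
    intro p
    have : regKernel d s δ (p.2 - p.1) = -regKernel d s δ (p.1 - p.2) := by
      rw [← regKernel_neg, neg_sub]
    simp only [hG, antisym, Prod.fst_swap, Prod.snd_swap, this]
    module
  rw [pairing, integral_congr_ae (Eventually.of_forall e),
    integral_add (f := fun p => (1 / 2 : ℝ) • G p) (g := fun p => (1 / 2 : ℝ) • G p.swap)
      (hGi.smul (1 / 2 : ℝ)) (hGi.swap.smul (1 / 2 : ℝ)), integral_smul, integral_smul,
    integral_prod_swap, ← add_smul]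
  norm_num
  rw [integral_prod _ hGi]
  refine integral_congr_ae (Eventually.of_forall fun x => ?_)
  simp only [hG, mul_smul]
  rw [integral_smul]

/-- Write `K = (K - K_δ) + K_δ` in the pairing. The `K_δ` part and the tail with `1 - ψ` add up to
the full integral of the truncated transform of `f`, and Fubini moves it onto `f`. The subtraction
of the pole `x₀`, which makes Fubini legitimate, costs nothing because `∫ f dμ = 0`. -/
lemma integral_identity [IsLocallyFiniteMeasure μ] (hs : 0 < s) (hδ : 0 < δ) (hΛ : 0 ≤ Λ)
    (hμ : IsNice s Λ μ) (hrefl : IsRieszReflectionless s μ) (hf : IsLipZero f)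
    (hf0 : ∫ x, f x ∂μ = 0) (hψ : IsCutoff f ψ)
    (hψδ : ∀ x y, f y ≠ 0 → ‖x - y‖ < δ → ψ x = 1) (x₀ : EuclideanSpace ℝ (Fin d)) :
    ∫ p : EuclideanSpace ℝ (Fin d) × EuclideanSpace ℝ (Fin d), antisym f ψ p.1 p.2 •
        (rieszKernel d s (p.1 - p.2) - regKernel d s δ (p.1 - p.2)) ∂(μ.prod μ) +
      ∫ y, f y • potDiff s δ μ x₀ y ∂μ = 0 := by
  have h0 := hrefl.2.2 f ψ hf hf0 hψ
  have hc := continuous_regKernel (d := d) hs hδ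
  set W : EuclideanSpace ℝ (Fin d) → EuclideanSpace ℝ (Fin d) :=
    fun x => ∫ y, f y • regKernel d s δ (x - y) ∂μ with hW
  obtain ⟨D, hD⟩ := hf.2.isCompact.isBounded.subset_closedBall x₀
  have hF := integrable_smul_regKernel_sub_sub (x₀ := x₀) (D := D) hs hδ hΛ hμ
    (hf.integrable (μ := μ)) fun y hy => by
      simpa [dist_eq_norm] using hD (subset_tsupport f hy)
  have hfK : ∀ x, Integrable (fun y => f y • regKernel d s δ (x - y)) μ := fun x =>
    hf.integrable.smul_of_top_left (memLp_top_of_bound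
      (Continuous.aestronglyMeasurable (by fun_prop)) (δ ^ (-s))
      (Eventually.of_forall fun p => norm_regKernel_le hs hδ _))
  have hWF : ∀ x, ∫ y, f y • (regKernel d s δ (x - y) - regKernel d s δ (x - x₀)) ∂μ = W x := by
    intro x
    simp only [smul_sub]
    rw [integral_sub (hfK x) (hf.integrable.smul_const _), integral_smul_const, hf0, zero_smul,
      sub_zero]
  have hWi : Integrable W μ := by
    refine hF.integral_prod_left.congr (Eventually.of_forall fun x => ?_)
    exact hWF x
  have hψW : Integrable (fun x => ψ x • W x) μ := by
    obtain ⟨B, -, hB⟩ := hψ.1.exists_abs_le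
    exact hWi.smul_of_top_right (memLp_top_of_bound
      hψ.1.continuous.aestronglyMeasurable B (Eventually.of_forall hB))
  -- Where `1 - ψ` is nonzero, `x` is at distance at least `δ` from every point with `f ≠ 0`, so the
  -- kernel and its truncation agree there.
  have h1 : ∫ x, ((1 - ψ x) * 1) • transform (rieszKernel d s) μ f x ∂μ =
      ∫ x, (W x - ψ x • W x) ∂μ := by
    refine integral_congr_ae (Eventually.of_forall fun x => ?_)
    by_cases hx : ψ x = 1
    · simp [hx]
    have : transform (rieszKernel d s) μ f x = W x := by
      refine integral_congr_ae (Eventually.of_forall fun y => ?_)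
      by_cases hy : f y = 0
      · simp [hy]
      simp only
      rw [regKernel_eq_rieszKernel]
      by_contra hlt
      exact hx (hψδ x y hy (not_le.1 hlt))
    simp only [this]
    module
  have hK := integrable_antisym_smul_rieszKernel hs hrefl.1 hf hψ.1
  have hR : Integrable (fun p : EuclideanSpace ℝ (Fin d) × EuclideanSpace ℝ (Fin d) =>
      antisym f ψ p.1 p.2 • regKernel d s δ (p.1 - p.2)) (μ.prod μ) := by
    have := ((integrable_mul_smul_regKernel (μ := μ) hs hδ hf hψ.1).sub
      (integrable_mul_smul_regKernel (μ := μ) hs hδ hψ.1 hf)).smul (1 / 2 : ℝ)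
    refine this.congr (Eventually.of_forall fun p => ?_)
    simp only [antisym, Pi.smul_apply, Pi.sub_apply]
    module
  have h2 : ∫ x, W x ∂μ = ∫ y, f y • potDiff s δ μ x₀ y ∂μ := by
    rw [← integral_congr_ae (Eventually.of_forall hWF), integral_integral_swap hF]
    refine integral_congr_ae (Eventually.of_forall fun y => ?_)
    simp only [potDiff]
    rw [integral_smul]
  simp only [smul_sub]
  rw [integral_sub hK hR, ← h2]
  have h3 := pairing_regKernel (μ := μ) hs hδ hf hψ.1
  rw [extendedPairing, h1, integral_sub hWi hψW] at h0
  simp only [mul_one] at h0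
  rw [pairing] at h3 h0
  rw [h3, ← h0]
  abel

end Identity

/-! ### Tent functions. -/

section Bump

variable {d : ℕ}

/-- The tent function equal to `1` on `B(z,ρ)` and to `0` off `B(z,2ρ)`. -/
noncomputable def tent (z : EuclideanSpace ℝ (Fin d)) (ρ : ℝ) (y : EuclideanSpace ℝ (Fin d)) : ℝ :=
  max 0 (min 1 (2 - ‖y - z‖ / ρ))

variable {z : EuclideanSpace ℝ (Fin d)} {ρ : ℝ}

lemma tent_nonneg (y : EuclideanSpace ℝ (Fin d)) : 0 ≤ tent z ρ y := le_max_left _ _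

lemma tent_eq_zero (hρ : 0 < ρ) {y : EuclideanSpace ℝ (Fin d)} (hy : 2 * ρ ≤ ‖y - z‖) :
    tent z ρ y = 0 := by
  have : 2 - ‖y - z‖ / ρ ≤ 0 := by
    rw [sub_nonpos, le_div_iff₀ hρ]; exact hy
  exact max_eq_left ((min_le_right _ _).trans this)

lemma tent_eq_one (hρ : 0 < ρ) {y : EuclideanSpace ℝ (Fin d)} (hy : ‖y - z‖ ≤ ρ) :
    tent z ρ y = 1 := by
  have : 1 ≤ 2 - ‖y - z‖ / ρ := by
    have := (div_le_one hρ).2 hy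
    linarith
  rw [tent, min_eq_left this, max_eq_right zero_le_one]

lemma abs_tent_sub_le (hρ : 0 < ρ) (x y : EuclideanSpace ℝ (Fin d)) :
    |tent z ρ x - tent z ρ y| ≤ ρ⁻¹ * ‖x - y‖ := by
  have h1 : |tent z ρ x - tent z ρ y| ≤ |(2 - ‖x - z‖ / ρ) - (2 - ‖y - z‖ / ρ)| := by
    rw [tent, tent, max_comm, max_comm 0, min_comm 1, min_comm 1]
    exact (abs_max_sub_max_le_abs _ _ _).trans (abs_inf_sub_inf_le_abs _ _ _)
  refine h1.trans ?_
  rw [show (2 - ‖x - z‖ / ρ) - (2 - ‖y - z‖ / ρ) = ρ⁻¹ * (‖y - z‖ - ‖x - z‖) by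
    field_simp; ring, abs_mul, abs_of_pos (inv_pos.2 hρ)]
  gcongr
  have := abs_norm_sub_norm_le (y - z) (x - z)
  rw [sub_sub_sub_cancel_right] at this
  rwa [norm_sub_rev x y]

lemma isLipZero_tent (hρ : 0 < ρ) : IsLipZero (tent z ρ) := by
  refine ⟨⟨_, LipschitzWith.of_dist_le' (K := ρ⁻¹) fun x y => ?_⟩,
    HasCompactSupport.intro (isCompact_closedBall z (2 * ρ)) fun y hy => ?_⟩
  · rw [Real.dist_eq, dist_eq_norm]
    exact abs_tent_sub_le hρ x y
  · rw [Metric.mem_closedBall, not_le, dist_eq_norm] at hy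
    exact tent_eq_zero hρ hy.le

lemma measure_ball_le_ofReal_integral_tent {μ : Measure (EuclideanSpace ℝ (Fin d))}
    [IsLocallyFiniteMeasure μ] (hρ : 0 < ρ) :
    μ (Metric.ball z ρ) ≤ ENNReal.ofReal (∫ y, tent z ρ y ∂μ) := by
  rw [ofReal_integral_eq_lintegral_ofReal (isLipZero_tent hρ).integrable
    (Eventually.of_forall tent_nonneg)]
  calc μ (Metric.ball z ρ) = ∫⁻ y in Metric.ball z ρ, 1 ∂μ := by simp
    _ ≤ ∫⁻ y in Metric.ball z ρ, ENNReal.ofReal (tent z ρ y) ∂μ := by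
        refine setLIntegral_mono' measurableSet_ball fun y hy => ?_
        rw [Metric.mem_ball, dist_eq_norm] at hy
        rw [tent_eq_one hρ hy.le, ENNReal.ofReal_one]
    _ ≤ _ := setLIntegral_le_lintegral _ _

end Bump

/-! ### Near and far parts of the interaction below scale `δ`. -/

section Local

variable {d : ℕ} {s : ℝ}

/-- Restricted to the complement of `B(z, h / 4^k)`, the measure has growth exponent `d + 1 > s`
about `z` at all radii up to `h`, so the singularity is integrable with a bound independent of `k`.
Beyond `h` the integrand is at most `h^(-s)`. -/
lemma exists_lintegral_far_le (hs0 : 0 < s) (hs : s < d + 1) :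
    ∃ C : ℝ, 0 < C ∧ ∀ (μ : Measure (EuclideanSpace ℝ (Fin d))) (z : EuclideanSpace ℝ (Fin d))
      (h R T : ℝ) (k : ℕ), 0 < h → 0 ≤ T →
      (∀ j ≤ k, (4 ^ (d + 1)) ^ j * μ (Metric.ball z (h / 4 ^ j)) ≤ ENNReal.ofReal T) →
      μ (Metric.ball z R) ≤ ENNReal.ofReal T →
      ∫⁻ y in (Metric.ball z (h / 4 ^ k))ᶜ ∩ Metric.ball z R, ENNReal.ofReal (‖y - z‖ ^ (-s)) ∂μ ≤
        ENNReal.ofReal (C * T * h ^ (-s)) := by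
  obtain ⟨C, hC0, hC⟩ := exists_lintegral_ball_rpow_le (d := d) (p := s) (β := (d + 1 : ℕ))
    (by positivity) (by exact_mod_cast hs)
  refine ⟨C * 4 ^ (d + 1) + 1, by positivity, fun μ z h R T k hh hT hj hR => ?_⟩
  have hball : ∀ t, 0 < t → t ≤ h → μ.restrict (Metric.ball z (h / 4 ^ k))ᶜ (Metric.ball z t) ≤
      ENNReal.ofReal ((4 / h) ^ (d + 1) * T * t ^ ((d + 1 : ℕ) : ℝ)) := by
    intro t ht hth
    rw [Measure.restrict_apply measurableSet_ball]
    rcases le_or_gt t (h / 4 ^ k) with htk | htk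
    · have : Metric.ball z t ∩ (Metric.ball z (h / 4 ^ k))ᶜ = ∅ := by
        rw [← Set.sdiff_eq, Set.sdiff_eq_empty]
        exact Metric.ball_subset_ball htk
      rw [this, measure_empty]
      exact zero_le
    -- The least such `j` satisfies `h / 4^(j+1) < t ≤ h / 4^j`, which turns the decay on the
    -- discrete scales into a bound at radius `t`.
    have hex : ∃ j : ℕ, h / 4 ^ (j + 1) < t :=
      ⟨k, lt_of_le_of_lt (by gcongr <;> norm_num) htk⟩
    classical
    set j := Nat.find hex with hjdef
    have hj1 : h / 4 ^ (j + 1) < t := Nat.find_spec hex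
    have hjk : j ≤ k := Nat.find_min' hex (lt_of_le_of_lt (by gcongr <;> norm_num) htk)
    have hj2 : t ≤ h / 4 ^ j := by
      rcases Nat.eq_zero_or_pos j with h0 | h0
      · rw [h0]; simpa using hth
      · have := Nat.find_min hex (m := j - 1) (by omega)
        rwa [not_lt, show j - 1 + 1 = j by omega] at this
    have hpow : ((4 : ℝ≥0∞) ^ (d + 1)) ^ j = ENNReal.ofReal ((4 ^ (d + 1)) ^ j) := by
      rw [ENNReal.ofReal_pow (by positivity), ENNReal.ofReal_pow (by positivity)]; norm_num
    calc _ ≤ μ (Metric.ball z (h / 4 ^ j)) :=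
          measure_mono (Set.inter_subset_left.trans (Metric.ball_subset_ball hj2))
      _ ≤ ENNReal.ofReal (((4 ^ (d + 1)) ^ j)⁻¹ * T) := by
          have := hj j hjk
          rw [hpow] at this
          rw [ENNReal.ofReal_mul (by positivity), ENNReal.ofReal_inv_of_pos (by positivity)]
          rwa [← ENNReal.mul_le_iff_le_inv (by positivity) (by finiteness)]
      _ ≤ _ := by
          refine ENNReal.ofReal_le_ofReal ?_
          rw [Real.rpow_natCast, mul_right_comm, ← mul_pow, ← pow_mul, mul_comm (d + 1) j, pow_mul,
            ← inv_pow]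
          gcongr
          rw [div_mul_eq_mul_div, inv_le_iff_one_le_mul₀ (by positivity), div_mul_eq_mul_div,
            one_le_div hh]
          rw [div_lt_iff₀ (by positivity), pow_succ] at hj1
          linarith
  have h1 := hC _ z _ h (by positivity) hh hball
  rw [Measure.restrict_restrict measurableSet_ball] at h1
  have hsplit : (Metric.ball z (h / 4 ^ k))ᶜ ∩ Metric.ball z R ⊆
      (Metric.ball z h ∩ (Metric.ball z (h / 4 ^ k))ᶜ) ∪ (Metric.ball z R \ Metric.ball z h) := by
    intro y hy
    by_cases hyh : y ∈ Metric.ball z h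
    · exact Or.inl ⟨hyh, hy.1⟩
    · exact Or.inr ⟨hy.2, hyh⟩
  have h2 : ∫⁻ y in Metric.ball z R \ Metric.ball z h, ENNReal.ofReal (‖y - z‖ ^ (-s)) ∂μ ≤
      ENNReal.ofReal (h ^ (-s) * T) := by
    calc _ ≤ ∫⁻ y in Metric.ball z R \ Metric.ball z h, ENNReal.ofReal (h ^ (-s)) ∂μ := by
          refine setLIntegral_mono' (measurableSet_ball.diff measurableSet_ball) fun y hy => ?_
          have := hy.2
          rw [Metric.mem_ball, not_lt, dist_eq_norm] at this
          exact ENNReal.ofReal_le_ofReal (Real.rpow_le_rpow_of_nonpos hh this (by linarith))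
      _ ≤ _ := by
          rw [setLIntegral_const, ENNReal.ofReal_mul (by positivity)]
          gcongr
          exact (measure_mono Set.sdiff_subset).trans hR
  refine (lintegral_mono_set hsplit).trans ((lintegral_union_le _ _ _).trans
    ((add_le_add h1 h2).trans ?_))
  rw [← ENNReal.ofReal_add (by positivity) (by positivity)]
  refine ENNReal.ofReal_le_ofReal (le_of_eq ?_)
  have : h ^ (((d + 1 : ℕ) : ℝ) - s) = h ^ (d + 1) * h ^ (-s) := by
    rw [sub_eq_add_neg, Real.rpow_add hh, Real.rpow_natCast]
  rw [this, div_pow]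
  field_simp

/-- Split at `|x - y| = θ ρ`. The inner part uses niceness and gains `θ`; the outer part uses only
the mass `m` of the ball, where `|x - y| ≤ 8 ρ`. -/
lemma exists_lintegral_near_le (d : ℕ) (hs0 : 0 < s) :
    ∃ C : ℝ, 0 < C ∧ ∀ (Λ : ℝ) (μ : Measure (EuclideanSpace ℝ (Fin d))), 0 ≤ Λ → IsNice s Λ μ →
      ∀ (x z : EuclideanSpace ℝ (Fin d)) (ρ θ m : ℝ), 0 < ρ → 0 < θ → 0 ≤ m →
      x ∈ Metric.ball z (4 * ρ) → μ (Metric.ball z (4 * ρ)) ≤ ENNReal.ofReal m →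
      ∫⁻ y in Metric.ball z (4 * ρ), ENNReal.ofReal (ρ⁻¹ * ‖x - y‖ ^ (1 - s)) ∂μ ≤
        ENNReal.ofReal (C * Λ * θ + 8 * θ ^ (-s) * (ρ ^ (-s) * m)) := by
  obtain ⟨C, hC0, hC⟩ := exists_lintegral_ball_rpow_le (d := d) (p := s - 1) (β := s) hs0
    (by linarith)
  refine ⟨C, hC0, fun Λ μ hΛ hμ x z ρ θ m hρ hθ hm hx hmz => ?_⟩
  have hθρ : 0 < θ * ρ := by positivity
  have h1 : ∫⁻ y in Metric.ball x (θ * ρ), ENNReal.ofReal (ρ⁻¹ * ‖x - y‖ ^ (1 - s)) ∂μ ≤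
      ENNReal.ofReal (C * Λ * θ) := by
    have := hC μ x Λ (θ * ρ) hΛ hθρ fun t ht _ => hμ x t ht
    rw [show s - (s - 1) = 1 by ring, Real.rpow_one, neg_sub] at this
    simp only [ENNReal.ofReal_mul (inv_pos.2 hρ).le, norm_sub_rev x]
    rw [lintegral_const_mul' _ _ ENNReal.ofReal_ne_top]
    refine (mul_le_mul_right this _).trans ?_
    rw [← ENNReal.ofReal_mul (by positivity)]
    refine ENNReal.ofReal_le_ofReal (le_of_eq ?_)
    field_simp
  have h2 : ∫⁻ y in Metric.ball z (4 * ρ) \ Metric.ball x (θ * ρ),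
      ENNReal.ofReal (ρ⁻¹ * ‖x - y‖ ^ (1 - s)) ∂μ ≤
      ENNReal.ofReal (8 * θ ^ (-s) * (ρ ^ (-s) * m)) := by
    calc _ ≤ ∫⁻ y in Metric.ball z (4 * ρ) \ Metric.ball x (θ * ρ),
          ENNReal.ofReal (8 * θ ^ (-s) * ρ ^ (-s)) ∂μ := by
          refine setLIntegral_mono' (measurableSet_ball.diff measurableSet_ball) fun y hy => ?_
          refine ENNReal.ofReal_le_ofReal ?_
          have hy1 := hy.2
          rw [Metric.mem_ball, not_lt, dist_eq_norm, norm_sub_rev] at hy1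
          have hy2 : ‖x - y‖ ≤ 8 * ρ := by
            have := dist_triangle_right x y z
            rw [← dist_eq_norm]
            have h3 := Metric.mem_ball.1 hx
            have h4 := Metric.mem_ball.1 hy.1
            linarith
          rw [sub_eq_add_neg 1 s, Real.rpow_add (hθρ.trans_le hy1), Real.rpow_one]
          calc _ ≤ ρ⁻¹ * ((8 * ρ) * (θ * ρ) ^ (-s)) := by
                gcongr ρ⁻¹ * (?_ * ?_)
                exact Real.rpow_le_rpow_of_nonpos hθρ hy1 (by linarith)
            _ = _ := by
                rw [Real.mul_rpow hθ.le hρ.le]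
                field_simp
      _ ≤ _ := by
          rw [setLIntegral_const]
          refine (mul_le_mul_right ((measure_mono Set.sdiff_subset).trans hmz) _).trans ?_
          rw [← ENNReal.ofReal_mul (by positivity), mul_assoc]
  have hsplit : Metric.ball z (4 * ρ) ⊆
      Metric.ball x (θ * ρ) ∪ (Metric.ball z (4 * ρ) \ Metric.ball x (θ * ρ)) := by
    rw [Set.union_sdiff_self]; exact Set.subset_union_right
  refine (lintegral_mono_set hsplit).trans ((lintegral_union_le _ _ _).trans
    ((add_le_add h1 h2).trans ?_))
  rw [← ENNReal.ofReal_add (by positivity) (by positivity)]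

/-- If both points lie in `B(z, 4ρ)`, the Lipschitz bound of the tent applies. If one lies outside,
only the tent at the other survives, which forces that one into `B(z, 2ρ)`: their distance is then
at least half the distance from the outer point to `z`. The kernel difference vanishes at distances
`≥ δ`, which confines the outer point to `B(z, 2δ)`. -/
lemma ofReal_abs_tent_sub_mul_norm_le (hs0 : 0 < s) {δ ρ : ℝ} (hδ : 0 < δ) (hρ : 0 < ρ)
    (hρδ : 2 * ρ ≤ δ) (z x y : EuclideanSpace ℝ (Fin d)) :
    ENNReal.ofReal (|tent z ρ y - tent z ρ x| *
      ‖rieszKernel d s (x - y) - regKernel d s δ (x - y)‖) ≤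
      (Metric.ball z (4 * ρ)).indicator (fun x => (Metric.ball z (4 * ρ)).indicator
        (fun y => ENNReal.ofReal (ρ⁻¹ * ‖x - y‖ ^ (1 - s))) y) x +
      (ENNReal.ofReal (tent z ρ x) * ((Metric.ball z (4 * ρ))ᶜ ∩ Metric.ball z (2 * δ)).indicator
        (fun y => ENNReal.ofReal (2 ^ s * ‖y - z‖ ^ (-s))) y +
      ENNReal.ofReal (tent z ρ y) * ((Metric.ball z (4 * ρ))ᶜ ∩ Metric.ball z (2 * δ)).indicator
        (fun y => ENNReal.ofReal (2 ^ s * ‖y - z‖ ^ (-s))) x) := by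
  have hzero : ∀ w, w ∉ Metric.ball z (4 * ρ) → tent z ρ w = 0 := by
    intro w hw
    rw [Metric.mem_ball, not_lt, dist_eq_norm] at hw
    exact tent_eq_zero hρ (by linarith)
  have hfar : ∀ w v : EuclideanSpace ℝ (Fin d), v ∉ Metric.ball z (4 * ρ) →
      ∀ N : ℝ, N ≤ ‖w - v‖ ^ (-s) → (δ ≤ ‖w - v‖ → N = 0) →
      ENNReal.ofReal (tent z ρ w * N) ≤ ENNReal.ofReal (tent z ρ w) *
        ((Metric.ball z (4 * ρ))ᶜ ∩ Metric.ball z (2 * δ)).indicator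
        (fun y => ENNReal.ofReal (2 ^ s * ‖y - z‖ ^ (-s))) v := by
    intro w v hv N hN hN0
    by_cases hw : tent z ρ w = 0
    · simp [hw]
    have hw2 : ‖w - z‖ < 2 * ρ := by
      by_contra hc
      exact hw (tent_eq_zero hρ (not_lt.1 hc))
    rcases le_or_gt δ ‖w - v‖ with hd | hd
    · rw [hN0 hd]; simp
    have hv' := hv
    rw [Metric.mem_ball, not_lt, dist_eq_norm] at hv'
    have htri1 : ‖v - z‖ ≤ ‖w - v‖ + ‖w - z‖ := by
      have := norm_sub_le (w - z) (w - v)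
      rw [sub_sub_sub_cancel_left] at this
      linarith
    rw [Set.indicator_of_mem (show v ∈ (Metric.ball z (4 * ρ))ᶜ ∩ Metric.ball z (2 * δ) from
        ⟨hv, by rw [Metric.mem_ball, dist_eq_norm]; linarith⟩),
      ENNReal.ofReal_mul (tent_nonneg _)]
    gcongr
    refine hN.trans ?_
    have : (‖v - z‖ / 2) ^ (-s) = 2 ^ s * ‖v - z‖ ^ (-s) := by
      rw [Real.div_rpow (norm_nonneg _) (by norm_num), Real.rpow_neg (by norm_num : (0:ℝ) ≤ 2),
        div_inv_eq_mul, mul_comm]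
    rw [← this]
    exact Real.rpow_le_rpow_of_nonpos (by linarith) (by linarith) (by linarith)
  have hL := norm_rieszKernel_sub_regKernel_le (d := d) hs0 hδ (x - y)
  have hL0 : δ ≤ ‖x - y‖ → ‖rieszKernel d s (x - y) - regKernel d s δ (x - y)‖ = 0 := by
    intro h
    rw [regKernel_eq_rieszKernel h, sub_self, norm_zero]
  by_cases hx : x ∈ Metric.ball z (4 * ρ)
  · by_cases hy : y ∈ Metric.ball z (4 * ρ)
    · refine le_add_right ?_
      rw [Set.indicator_of_mem hx, Set.indicator_of_mem hy]
      rcases eq_or_ne x y with rfl | hne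
      · simp
      have hpos : 0 < ‖x - y‖ := norm_pos_iff.2 (sub_ne_zero.2 hne)
      refine ENNReal.ofReal_le_ofReal ?_
      rw [sub_eq_add_neg 1 s, Real.rpow_add hpos, Real.rpow_one, ← mul_assoc, abs_sub_comm]
      gcongr
      exact abs_tent_sub_le hρ x y
    · refine le_add_left (le_add_right ?_)
      rw [hzero y hy, zero_sub, abs_neg, abs_of_nonneg (tent_nonneg _)]
      exact hfar x y hy _ hL hL0
  · refine le_add_left (le_add_left ?_)
    rw [hzero x hx, sub_zero, abs_of_nonneg (tent_nonneg _)]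
    exact hfar y x hx _ (by rw [norm_sub_rev y x]; exact hL) (by rw [norm_sub_rev y x]; exact hL0)

end Local

/-! ### Normalised bumps, and smallness of the potential of a reflectionless measure. -/

section Key

variable {d : ℕ} {s : ℝ}

lemma lintegral_prod_tent_le {μ : Measure (EuclideanSpace ℝ (Fin d))} [IsLocallyFiniteMeasure μ]
    (hs0 : 0 < s) {δ ρ cA cF : ℝ} {z : EuclideanSpace ℝ (Fin d)} (hδ : 0 < δ) (hρ : 0 < ρ)
    (hρδ : 2 * ρ ≤ δ)
    (hA : ∀ x ∈ Metric.ball z (4 * ρ), ∫⁻ y in Metric.ball z (4 * ρ),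
      ENNReal.ofReal (ρ⁻¹ * ‖x - y‖ ^ (1 - s)) ∂μ ≤ ENNReal.ofReal cA)
    (hF : ∫⁻ y in (Metric.ball z (4 * ρ))ᶜ ∩ Metric.ball z (2 * δ),
      ENNReal.ofReal (‖y - z‖ ^ (-s)) ∂μ ≤ ENNReal.ofReal cF) :
    ∫⁻ p : EuclideanSpace ℝ (Fin d) × EuclideanSpace ℝ (Fin d),
      ENNReal.ofReal (|tent z ρ p.2 - tent z ρ p.1| *
        ‖rieszKernel d s (p.1 - p.2) - regKernel d s δ (p.1 - p.2)‖) ∂(μ.prod μ) ≤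
      ENNReal.ofReal cA * μ (Metric.ball z (4 * ρ)) +
        ENNReal.ofReal 2 * (ENNReal.ofReal (∫ y, tent z ρ y ∂μ) * (ENNReal.ofReal (2 ^ s) * ENNReal.ofReal cF)) := by
  set B := Metric.ball z (4 * ρ) with hB
  set S := Bᶜ ∩ Metric.ball z (2 * δ) with hS
  have hBm : MeasurableSet B := measurableSet_ball
  have hSm : MeasurableSet S := hBm.compl.inter measurableSet_ball
  set g : EuclideanSpace ℝ (Fin d) → ℝ≥0∞ :=
    S.indicator (fun y => ENNReal.ofReal (2 ^ s * ‖y - z‖ ^ (-s))) with hg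
  have hgm : Measurable g := Measurable.indicator (by fun_prop) hSm
  have hgI : ∫⁻ y, g y ∂μ ≤ ENNReal.ofReal (2 ^ s) * ENNReal.ofReal cF := by
    rw [hg, lintegral_indicator hSm]
    simp only [ENNReal.ofReal_mul (show (0 : ℝ) ≤ 2 ^ s by positivity)]
    rw [lintegral_const_mul' _ _ ENNReal.ofReal_ne_top]
    gcongr
  have htc : Continuous (tent z ρ) := (isLipZero_tent hρ).continuous
  have hcK : Continuous (regKernel d s δ) := continuous_regKernel hs0 hδ
  have htI : ∫⁻ y, ENNReal.ofReal (tent z ρ y) ∂μ = ENNReal.ofReal (∫ y, tent z ρ y ∂μ) :=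
    (ofReal_integral_eq_lintegral_ofReal (isLipZero_tent hρ).integrable
      (Eventually.of_forall tent_nonneg)).symm
  have hm : Measurable fun p : EuclideanSpace ℝ (Fin d) × EuclideanSpace ℝ (Fin d) =>
      ENNReal.ofReal (|tent z ρ p.2 - tent z ρ p.1| *
        ‖rieszKernel d s (p.1 - p.2) - regKernel d s δ (p.1 - p.2)‖) := by
    have h1 := htc.measurable
    have h2 := hcK.measurable
    have h3 := measurable_rieszKernel (d := d) (s := s)
    have h4 : Measurable fun t : ℝ => |t| := continuous_abs.measurable
    exact ENNReal.measurable_ofReal.comp ((h4.comp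
      ((h1.comp measurable_snd).sub (h1.comp measurable_fst))).mul
      ((h3.comp (measurable_fst.sub measurable_snd)).sub
        (h2.comp (measurable_fst.sub measurable_snd))).norm)
  rw [lintegral_prod _ hm.aemeasurable]
  have hinner : ∀ x, ∫⁻ y, ENNReal.ofReal (|tent z ρ y - tent z ρ x| *
      ‖rieszKernel d s (x - y) - regKernel d s δ (x - y)‖) ∂μ ≤
      B.indicator (fun _ => ENNReal.ofReal cA) x + (ENNReal.ofReal (tent z ρ x) *
        (ENNReal.ofReal (2 ^ s) * ENNReal.ofReal cF) +
        ENNReal.ofReal (∫ y, tent z ρ y ∂μ) * g x) := by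
    intro x
    refine (lintegral_mono fun y =>
      ofReal_abs_tent_sub_mul_norm_le hs0 hδ hρ hρδ z x y).trans ?_
    rw [lintegral_add_right _ (by fun_prop), lintegral_add_left (by fun_prop),
      lintegral_const_mul _ hgm, lintegral_mul_const _ (by fun_prop), htI]
    gcongr
    simp only [← hB]
    by_cases hx : x ∈ B
    · simp only [Set.indicator_of_mem hx]
      rw [lintegral_indicator hBm]
      exact hA x hx
    · simp [Set.indicator_of_notMem hx]
  refine (lintegral_mono hinner).trans ?_
  rw [lintegral_add_left (measurable_const.indicator hBm), lintegral_add_left (by fun_prop),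
    lintegral_indicator hBm, setLIntegral_const, lintegral_mul_const _ (by fun_prop), htI,
    lintegral_const_mul _ hgm, ENNReal.ofReal_ofNat, two_mul]
  gcongr

/-- The bump is a tent at a doubling point `z` and scale `ρ = h / 4^(k+1)`, divided by its integral
`M`. Doubling bounds `μ(B(z, 4ρ))` by a multiple of `M`, so the normalisation is harmless however
small `M` is; decay at the larger scales controls both the density of `μ` at scale `ρ` and the far
interaction. -/
lemma exists_normalized_tent (hs0 : 0 < s) (hs : s < d + 1) :
    ∃ C : ℝ, 0 < C ∧ ∀ (Λ : ℝ) (μ : Measure (EuclideanSpace ℝ (Fin d))) [IsLocallyFiniteMeasure μ],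
      0 ≤ Λ → IsNice s Λ μ → ∀ (x : EuclideanSpace ℝ (Fin d)) (h δ θ : ℝ), 0 < h → h ≤ δ →
      0 < θ → θ ≤ 1 → 0 < μ (Metric.ball x h) →
      ∃ φ : EuclideanSpace ℝ (Fin d) → ℝ, IsLipZero φ ∧ (∀ y, 0 ≤ φ y) ∧
        (∀ y, φ y ≠ 0 → ‖y - x‖ ≤ 2 * h) ∧ ∫ y, φ y ∂μ = 1 ∧
        ∫⁻ p : EuclideanSpace ℝ (Fin d) × EuclideanSpace ℝ (Fin d),
          ENNReal.ofReal (|φ p.2 - φ p.1| *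
            ‖rieszKernel d s (p.1 - p.2) - regKernel d s δ (p.1 - p.2)‖) ∂(μ.prod μ) ≤
          ENNReal.ofReal (C * (Λ * θ + θ ^ (-s) * (h ^ (-s) * μ.real (Metric.ball x (3 * δ))))) := by
  obtain ⟨CF, hCF, hfar⟩ := exists_lintegral_far_le (d := d) hs0 hs
  obtain ⟨CN, hCN, hnear⟩ := exists_lintegral_near_le d hs0
  set C := 4 ^ (d + 1) * (CN + 8 * 4 ^ s) + 2 * (2 ^ s * CF) with hC
  refine ⟨C, by positivity, fun Λ μ _ hΛ hμ x h δ θ hh hhδ hθ hθ1 hpos => ?_⟩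
  obtain ⟨z, hz, k, hm0, hdoub, hdecay⟩ := exists_doubling_point μ hh hpos
  have hδ : 0 < δ := hh.trans_le hhδ
  set T := μ.real (Metric.ball x (3 * δ)) with hT
  have hT0 : 0 ≤ T := measureReal_nonneg
  have hTeq : μ (Metric.ball x (3 * δ)) = ENNReal.ofReal T :=
    (ENNReal.ofReal_toReal measure_ball_lt_top.ne).symm
  have hzx := Metric.mem_ball.1 hz
  have hzT : ∀ R, R ≤ 2 * δ → μ (Metric.ball z R) ≤ ENNReal.ofReal T := by
    intro R hR
    rw [← hTeq]
    exact measure_mono (Metric.ball_subset_ball' (by linarith))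
  set ρ := h / 4 ^ (k + 1) with hρdef
  have hρ : 0 < ρ := by positivity
  have h4ρ : h / 4 ^ k = 4 * ρ := by rw [hρdef, pow_succ]; field_simp
  have hρh : 4 * ρ ≤ h := by rw [← h4ρ]; exact div_le_self hh.le (one_le_pow₀ (by norm_num))
  set M := ∫ y, tent z ρ y ∂μ with hM
  have hρM : μ (Metric.ball z ρ) ≤ ENNReal.ofReal M := measure_ball_le_ofReal_integral_tent hρ
  have hM0 : 0 < M := ENNReal.ofReal_pos.1 (hm0.trans_le hρM)
  set mk := μ.real (Metric.ball z (4 * ρ)) with hmk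
  have hmkeq : μ (Metric.ball z (4 * ρ)) = ENNReal.ofReal mk :=
    (ENNReal.ofReal_toReal measure_ball_lt_top.ne).symm
  have hmk0 : 0 ≤ mk := measureReal_nonneg
  have hmkM : mk ≤ 4 ^ (d + 1) * M := by
    have h1 : ENNReal.ofReal mk ≤ ENNReal.ofReal (4 ^ (d + 1) * M) := by
      rw [← hmkeq, ← h4ρ, ENNReal.ofReal_mul (by positivity), ENNReal.ofReal_pow (by norm_num)]
      refine hdoub.trans ?_
      norm_num
      gcongr
    exact (ENNReal.ofReal_le_ofReal_iff (by positivity)).1 h1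
  -- Passing from scale `h` to `ρ` multiplies the power by `4^(s(k+1))`, while the mass loses
  -- `4^((d+1)k)`; since `s < d + 1`, only `4^s` is left.
  have hmkT : ρ ^ (-s) * mk ≤ 4 ^ s * (h ^ (-s) * T) := by
    have h1 : (4 ^ (d + 1)) ^ k * mk ≤ T := by
      have h2 := (hdecay k le_rfl).trans (hzT h (by linarith))
      rw [h4ρ, hmkeq] at h2
      have h3 : ((4 : ℝ≥0∞) ^ (d + 1)) ^ k = ENNReal.ofReal ((4 ^ (d + 1)) ^ k) := by
        rw [ENNReal.ofReal_pow (by positivity), ENNReal.ofReal_pow (by positivity)]; norm_num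
      rw [h3, ← ENNReal.ofReal_mul (by positivity)] at h2
      exact (ENNReal.ofReal_le_ofReal_iff hT0).1 h2
    have h4 : ρ ^ (-s) = h ^ (-s) * 4 ^ s * (4 ^ s) ^ k := by
      rw [hρdef, Real.div_rpow hh.le (by positivity), Real.rpow_neg (by positivity : (0:ℝ) ≤ 4 ^ _),
        div_inv_eq_mul, mul_assoc, ← Real.rpow_natCast, ← Real.rpow_mul (by norm_num),
        ← Real.rpow_natCast (4 ^ s), ← Real.rpow_mul (by norm_num), ← Real.rpow_add (by norm_num)]
      congr 2
      push_cast; ring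
    have h5 : ((4 : ℝ) ^ s) ^ k ≤ (4 ^ (d + 1)) ^ k := by
      refine pow_le_pow_left₀ (by positivity) ?_ k
      rw [← Real.rpow_natCast]
      exact Real.rpow_le_rpow_of_exponent_le (by norm_num) (by push_cast; exact hs.le)
    calc _ = h ^ (-s) * 4 ^ s * ((4 ^ s) ^ k * mk) := by rw [h4]; ring
      _ ≤ h ^ (-s) * 4 ^ s * ((4 ^ (d + 1)) ^ k * mk) := by gcongr
      _ ≤ h ^ (-s) * 4 ^ s * T := by gcongr
      _ = _ := by ring
  have hF := hfar μ z h (2 * δ) T k hh hT0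
    (fun j hj => (hdecay j hj).trans (hzT h (by linarith))) (hzT _ le_rfl)
  rw [h4ρ] at hF
  have hmain := lintegral_prod_tent_le (μ := μ) (z := z) hs0 hδ hρ (by linarith)
    (fun x hx => hnear Λ μ hΛ hμ x z ρ θ mk hρ hθ hmk0 hx hmkeq.le) hF
  have hθs : 1 ≤ θ ^ (-s) := Real.one_le_rpow_of_pos_of_le_one_of_nonpos hθ hθ1 (by linarith)
  have htotal : ∫⁻ p : EuclideanSpace ℝ (Fin d) × EuclideanSpace ℝ (Fin d),
      ENNReal.ofReal (|tent z ρ p.2 - tent z ρ p.1| *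
        ‖rieszKernel d s (p.1 - p.2) - regKernel d s δ (p.1 - p.2)‖) ∂(μ.prod μ) ≤
      ENNReal.ofReal (M * (C * (Λ * θ + θ ^ (-s) * (h ^ (-s) * T)))) := by
    refine hmain.trans ?_
    rw [hmkeq, ← ENNReal.ofReal_mul (by positivity), ← ENNReal.ofReal_mul (by positivity),
      ← ENNReal.ofReal_mul (by positivity), ← ENNReal.ofReal_mul (by positivity),
      ← ENNReal.ofReal_add (by positivity) (by positivity)]
    refine ENNReal.ofReal_le_ofReal ?_
    set H := h ^ (-s) * T with hH
    have hH0 : 0 ≤ H := by positivity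
    have hHθ : H ≤ θ ^ (-s) * H := le_mul_of_one_le_left hH0 hθs
    calc (CN * Λ * θ + 8 * θ ^ (-s) * (ρ ^ (-s) * mk)) * mk +
          2 * (M * (2 ^ s * (CF * T * h ^ (-s))))
        ≤ (CN * Λ * θ + 8 * θ ^ (-s) * (4 ^ s * H)) * (4 ^ (d + 1) * M) +
          2 * (M * (2 ^ s * (CF * (θ ^ (-s) * H)))) := by
          have e : CF * T * h ^ (-s) = CF * H := by rw [hH]; ring
          rw [e]
          gcongr
      _ = M * ((4 ^ (d + 1) * CN) * (Λ * θ) +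
          (4 ^ (d + 1) * (8 * 4 ^ s) + 2 * (2 ^ s * CF)) * (θ ^ (-s) * H)) := by ring
      _ ≤ M * (C * (Λ * θ) + C * (θ ^ (-s) * H)) := by
          have i1 : (4 : ℝ) ^ (d + 1) * CN ≤ C := by
            rw [hC, mul_add, add_assoc]
            exact le_add_of_nonneg_right (by positivity)
          have i2 : (4 : ℝ) ^ (d + 1) * (8 * 4 ^ s) + 2 * (2 ^ s * CF) ≤ C := by
            rw [hC, mul_add, add_assoc]
            exact le_add_of_nonneg_left (by positivity)
          gcongr
      _ = _ := by ring
  refine ⟨fun y => M⁻¹ * tent z ρ y, ⟨?_, (isLipZero_tent hρ).2.mul_left⟩,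
    fun y => mul_nonneg (inv_pos.2 hM0).le (tent_nonneg y), fun y hy => ?_, ?_, ?_⟩
  · obtain ⟨⟨K, hK⟩, -⟩ := isLipZero_tent (z := z) hρ
    refine ⟨_, LipschitzWith.of_dist_le' (K := M⁻¹ * K) fun x y => ?_⟩
    rw [Real.dist_eq, ← mul_sub, abs_mul, abs_of_pos (inv_pos.2 hM0), mul_assoc]
    gcongr
    exact hK.dist_le_mul x y
  · have h1 : ‖y - z‖ < 2 * ρ := by
      by_contra hc
      exact hy (by simp [tent_eq_zero hρ (not_lt.1 hc)])
    have := dist_triangle y z x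
    rw [dist_eq_norm, dist_eq_norm y z] at this
    linarith
  · rw [integral_const_mul, ← hM, inv_mul_cancel₀ hM0.ne']
  · have e : ∀ p : EuclideanSpace ℝ (Fin d) × EuclideanSpace ℝ (Fin d),
        ENNReal.ofReal (|M⁻¹ * tent z ρ p.2 - M⁻¹ * tent z ρ p.1| *
          ‖rieszKernel d s (p.1 - p.2) - regKernel d s δ (p.1 - p.2)‖) =
        ENNReal.ofReal M⁻¹ * ENNReal.ofReal (|tent z ρ p.2 - tent z ρ p.1| *
          ‖rieszKernel d s (p.1 - p.2) - regKernel d s δ (p.1 - p.2)‖) := by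
      intro p
      rw [← ENNReal.ofReal_mul (inv_pos.2 hM0).le, ← mul_sub, abs_mul,
        abs_of_pos (inv_pos.2 hM0), mul_assoc]
    simp only [e]
    rw [lintegral_const_mul' _ _ ENNReal.ofReal_ne_top]
    refine (mul_le_mul_right htotal _).trans ?_
    rw [← ENNReal.ofReal_mul (inv_pos.2 hM0).le, inv_mul_cancel_left₀ hM0.ne']

lemma exists_cutoff {f : EuclideanSpace ℝ (Fin d) → ℝ} {x : EuclideanSpace ℝ (Fin d)} {R δ : ℝ}
    (hR : 0 ≤ R) (hδ : 0 < δ) (hf : ∀ y, f y ≠ 0 → ‖y - x‖ ≤ R) :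
    ∃ ψ, IsCutoff f ψ ∧ ∀ x y, f y ≠ 0 → ‖x - y‖ < δ → ψ x = 1 := by
  have hRδ : 0 < R + δ := by positivity
  refine ⟨tent x (R + δ), ⟨isLipZero_tent hRδ, ?_⟩, fun u y hy huy => tent_eq_one hRδ ?_⟩
  · have h1 : tsupport f ⊆ Metric.closedBall x R := by
      refine closure_minimal (fun y hy => ?_) Metric.isClosed_closedBall
      rw [Metric.mem_closedBall, dist_eq_norm]
      exact hf y hy
    have h2 : Metric.ball x (R + δ) ∈ 𝓝ˢ (tsupport f) :=
      Metric.isOpen_ball.mem_nhdsSet.2 (h1.trans (Metric.closedBall_subset_ball (by linarith)))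
    filter_upwards [h2] with y hy
    rw [Metric.mem_ball, dist_eq_norm] at hy
    exact tent_eq_one hRδ hy.le
  · have := norm_add_le (u - y) (y - x)
    rw [sub_add_sub_cancel] at this
    linarith [hf y hy]

lemma IsLipZero.sub {f g : EuclideanSpace ℝ (Fin d) → ℝ} (hf : IsLipZero f) (hg : IsLipZero g) :
    IsLipZero (fun y => f y - g y) := by
  obtain ⟨⟨Cf, hCf⟩, hf2⟩ := hf
  obtain ⟨⟨Cg, hCg⟩, hg2⟩ := hg
  exact ⟨⟨_, hCf.sub hCg⟩, hf2.sub hg2⟩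

lemma norm_integral_smul_sub_le {μ : Measure (EuclideanSpace ℝ (Fin d))} [IsLocallyFiniteMeasure μ]
    {φ : EuclideanSpace ℝ (Fin d) → ℝ} {U : EuclideanSpace ℝ (Fin d) → EuclideanSpace ℝ (Fin d)}
    {v : EuclideanSpace ℝ (Fin d)} {B : ℝ} (hφ : IsLipZero φ) (hφ0 : ∀ y, 0 ≤ φ y)
    (hφ1 : ∫ y, φ y ∂μ = 1) (hU : Continuous U) (hB : ∀ y, φ y ≠ 0 → ‖U y - v‖ ≤ B) :
    Integrable (fun y => φ y • U y) μ ∧ ‖∫ y, φ y • U y ∂μ - v‖ ≤ B := by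
  have hi : Integrable (fun y => φ y • U y) μ :=
    (hφ.continuous.smul hU).integrable_of_hasCompactSupport hφ.2.smul_right
  refine ⟨hi, ?_⟩
  have e : ∫ y, φ y • U y ∂μ - v = ∫ y, φ y • (U y - v) ∂μ := by
    simp only [smul_sub]
    rw [integral_sub hi (hφ.integrable.smul_const v), integral_smul_const, hφ1, one_smul]
  rw [e]
  calc _ ≤ ∫ y, φ y * B ∂μ := by
        refine norm_integral_le_of_norm_le (hφ.integrable.mul_const B)
          (Eventually.of_forall fun y => ?_)
        rw [norm_smul, Real.norm_of_nonneg (hφ0 y)]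
        by_cases hy : φ y = 0
        · simp [hy]
        · exact mul_le_mul_of_nonneg_left (hB y hy) (hφ0 y)
    _ = B := by rw [integral_mul_const, hφ1, one_mul]

/-- At distances `≥ δ` the kernel difference is zero; closer in, `ψ = 1` wherever it multiplies a
nonzero value of `f`. -/
lemma norm_antisym_smul_le {f ψ : EuclideanSpace ℝ (Fin d) → ℝ} {δ : ℝ}
    (hψ : ∀ x y, f y ≠ 0 → ‖x - y‖ < δ → ψ x = 1) (x y : EuclideanSpace ℝ (Fin d)) :
    ‖antisym f ψ x y • (rieszKernel d s (x - y) - regKernel d s δ (x - y))‖ ≤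
      |f y - f x| * ‖rieszKernel d s (x - y) - regKernel d s δ (x - y)‖ := by
  rcases le_or_gt δ ‖x - y‖ with h | h
  · simp [regKernel_eq_rieszKernel h]
  have h1 : f y * ψ x = f y := by
    by_cases hy : f y = 0
    · simp [hy]
    · rw [hψ x y hy h, mul_one]
  have h2 : ψ y * f x = f x := by
    by_cases hx : f x = 0
    · simp [hx]
    · rw [hψ y x hx (by rwa [norm_sub_rev]), one_mul]
  rw [norm_smul, antisym, h1, h2, norm_mul, Real.norm_eq_abs (f y - f x)]
  gcongr
  refine mul_le_of_le_one_left (abs_nonneg _) ?_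
  norm_num

/-- A reflectionless nice measure which charges small balls near `x` and `x₀` has nearly equal
regularised potentials there. -/
lemma exists_norm_potDiff_le (hs0 : 0 < s) (hs : s < d + 1) :
    ∃ C : ℝ, 0 < C ∧ ∀ (Λ : ℝ) (μ : Measure (EuclideanSpace ℝ (Fin d))) [IsLocallyFiniteMeasure μ],
      0 ≤ Λ → IsNice s Λ μ → IsRieszReflectionless s μ →
      ∀ (x x₀ : EuclideanSpace ℝ (Fin d)) (δ θ : ℝ), 0 < δ → 0 < θ → θ ≤ 1 / 2 →
      0 < μ (Metric.ball x (θ * δ)) → 0 < μ (Metric.ball x₀ (θ * δ)) →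
      ‖potDiff s δ μ x₀ x‖ ≤ C * (Λ * θ + θ ^ (-s) * ((θ * δ) ^ (-s) *
        (μ.real (Metric.ball x (3 * δ)) + μ.real (Metric.ball x₀ (3 * δ))))) := by
  obtain ⟨C1, hC1, hloc⟩ := exists_normalized_tent (d := d) hs0 hs
  obtain ⟨C2, hC2, hosc⟩ := exists_norm_potDiff_sub_le d hs0
  refine ⟨4 * C2 + 2 * C1, by positivity,
    fun Λ μ _ hΛ hμ hrefl x x₀ δ θ hδ hθ hθ2 hx hx₀ => ?_⟩
  have hh : 0 < θ * δ := by positivity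
  -- The bumps live within `2θδ` of their centres, so `θ ≤ 1/2` keeps them within the range of the
  -- oscillation bound.
  have hhδ : 2 * (θ * δ) ≤ δ := by nlinarith
  obtain ⟨φ, hφ, hφ0, hφs, hφ1, hφL⟩ := hloc Λ μ hΛ hμ x (θ * δ) δ θ hh (by linarith) hθ
    (by linarith) hx
  obtain ⟨χ, hχ, hχ0, hχs, hχ1, hχL⟩ := hloc Λ μ hΛ hμ x₀ (θ * δ) δ θ hh (by linarith) hθ
    (by linarith) hx₀
  set U := potDiff s δ μ x₀ with hU
  have hUc : Continuous U := continuous_potDiff hs0 hδ hΛ hμ x₀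
  have hU0 : U x₀ = 0 := by simp [hU, potDiff]
  have hoscx : ∀ v y, ‖y - v‖ ≤ 2 * (θ * δ) → ‖U y - U v‖ ≤ 2 * C2 * Λ * θ := by
    intro v y hy
    refine (hosc Λ μ hΛ hμ x₀ y v δ hδ (hy.trans hhδ)).trans ?_
    rw [div_le_iff₀ hδ]
    calc C2 * Λ * ‖y - v‖ ≤ C2 * Λ * (2 * (θ * δ)) := by gcongr
      _ = _ := by ring
  obtain ⟨hi1, hn1⟩ := norm_integral_smul_sub_le hφ hφ0 hφ1 hUc fun y hy => hoscx x y (hφs y hy)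
  obtain ⟨hi2, hn2⟩ := norm_integral_smul_sub_le hχ hχ0 hχ1 hUc fun y hy => hoscx x₀ y (hχs y hy)
  rw [hU0, sub_zero] at hn2
  have hf := hφ.sub hχ
  have hf0 : ∫ y, (φ y - χ y) ∂μ = 0 := by
    rw [integral_sub hφ.integrable hχ.integrable, hφ1, hχ1, sub_self]
  obtain ⟨ψ, hψ, hψδ⟩ := exists_cutoff (f := fun y => φ y - χ y) (x := x)
    (R := 2 * (θ * δ) + ‖x - x₀‖) (by positivity) hδ (by
      intro y hy
      by_cases h1 : φ y = 0
      · have h2 : χ y ≠ 0 := fun h => hy (by simp [h1, h])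
        have h3 := norm_add_le (y - x₀) (x₀ - x)
        rw [sub_add_sub_cancel, norm_sub_rev x₀] at h3
        linarith [hχs y h2]
      · linarith [hφs y h1, norm_nonneg (x - x₀)])
  have hid := integral_identity hs0 hδ hΛ hμ hrefl hf hf0 hψ hψδ x₀
  set q := θ ^ (-s) * (θ * δ) ^ (-s) with hq
  set T := μ.real (Metric.ball x (3 * δ)) with hT
  set T₀ := μ.real (Metric.ball x₀ (3 * δ)) with hT₀
  have hTn : 0 ≤ T := measureReal_nonneg
  have hTn₀ : 0 ≤ T₀ := measureReal_nonneg
  have hpair : ‖∫ p : EuclideanSpace ℝ (Fin d) × EuclideanSpace ℝ (Fin d),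
      antisym (fun y => φ y - χ y) ψ p.1 p.2 •
        (rieszKernel d s (p.1 - p.2) - regKernel d s δ (p.1 - p.2)) ∂(μ.prod μ)‖ ≤
      C1 * (2 * Λ * θ + q * (T + T₀)) := by
    have hmeas : ∀ g : EuclideanSpace ℝ (Fin d) → ℝ, IsLipZero g → Measurable
        fun p : EuclideanSpace ℝ (Fin d) × EuclideanSpace ℝ (Fin d) =>
          ENNReal.ofReal (|g p.2 - g p.1| *
            ‖rieszKernel d s (p.1 - p.2) - regKernel d s δ (p.1 - p.2)‖) := by
      intro g hg
      have h1 := hg.continuous.measurable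
      have h2 := (continuous_regKernel (d := d) hs0 hδ).measurable
      have h3 := measurable_rieszKernel (d := d) (s := s)
      have h4 : Measurable fun t : ℝ => |t| := continuous_abs.measurable
      exact ENNReal.measurable_ofReal.comp ((h4.comp
        ((h1.comp measurable_snd).sub (h1.comp measurable_fst))).mul
        ((h3.comp (measurable_fst.sub measurable_snd)).sub
          (h2.comp (measurable_fst.sub measurable_snd))).norm)
    rw [← ENNReal.ofReal_le_ofReal_iff (by positivity), ofReal_norm]
    refine (enorm_integral_le_lintegral_enorm _).trans ?_
    calc _ ≤ ∫⁻ p : EuclideanSpace ℝ (Fin d) × EuclideanSpace ℝ (Fin d),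
          (ENNReal.ofReal (|φ p.2 - φ p.1| *
            ‖rieszKernel d s (p.1 - p.2) - regKernel d s δ (p.1 - p.2)‖) +
          ENNReal.ofReal (|χ p.2 - χ p.1| *
            ‖rieszKernel d s (p.1 - p.2) - regKernel d s δ (p.1 - p.2)‖)) ∂(μ.prod μ) := by
          refine lintegral_mono fun p => ?_
          rw [← ofReal_norm, ← ENNReal.ofReal_add (by positivity) (by positivity), ← add_mul]
          refine ENNReal.ofReal_le_ofReal ((norm_antisym_smul_le hψδ p.1 p.2).trans ?_)
          gcongr
          rw [show φ p.2 - χ p.2 - (φ p.1 - χ p.1) = (φ p.2 - φ p.1) - (χ p.2 - χ p.1) by ring]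
          exact abs_sub _ _
      _ ≤ _ := by
          rw [lintegral_add_left (hmeas φ hφ)]
          refine (add_le_add hφL hχL).trans ?_
          rw [← ENNReal.ofReal_add (by positivity) (by positivity)]
          exact ENNReal.ofReal_le_ofReal (le_of_eq (by rw [hq]; ring))
  simp only [sub_smul] at hid
  rw [integral_sub hi1 hi2] at hid
  set P := ∫ p : EuclideanSpace ℝ (Fin d) × EuclideanSpace ℝ (Fin d),
      antisym (fun y => φ y - χ y) ψ p.1 p.2 •
        (rieszKernel d s (p.1 - p.2) - regKernel d s δ (p.1 - p.2)) ∂(μ.prod μ) with hP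
  set I1 := ∫ y, φ y • U y ∂μ with hI1
  set I2 := ∫ y, χ y • U y ∂μ with hI2
  -- `I1` and `I2` are the averages of `U` near `x` and near `x₀`; the identity gives `I1 - I2 =
  -- -P`, and `I2` is itself small because `U x₀ = 0`.
  have hdec : U x = I2 - P - (I1 - U x) := by
    have : I1 - I2 = -P := by rw [eq_neg_iff_add_eq_zero, add_comm]; exact hid
    rw [sub_eq_iff_eq_add] at this
    rw [this]; abel
  calc ‖U x‖ ≤ ‖I2‖ + ‖P‖ + ‖I1 - U x‖ := by
        conv_lhs => rw [hdec]
        exact (norm_sub_le _ _).trans (add_le_add_left (norm_sub_le _ _) _)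
    _ ≤ 2 * C2 * Λ * θ + C1 * (2 * Λ * θ + q * (T + T₀)) + 2 * C2 * Λ * θ := by gcongr
    _ = (4 * C2 + 2 * C1) * (Λ * θ) + C1 * (q * (T + T₀)) := by ring
    _ ≤ (4 * C2 + 2 * C1) * (Λ * θ) + (4 * C2 + 2 * C1) * (q * (T + T₀)) := by
        gcongr
        linarith
    _ = _ := by rw [hq]; ring

end Key

/-! ### Integration by parts against the kernel, and the lower bound for its divergence. -/

section Divergence

variable {d : ℕ} {s δ : ℝ}

lemma measurable_regDiv : Measurable (regDiv d s δ) := by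
  unfold regDiv
  exact Measurable.ite (measurableSet_lt (by fun_prop) measurable_const) (by fun_prop) (by fun_prop)

lemma abs_regDiv_le (hs0 : 0 < s) (hs : s ≤ (d : ℝ) - 1) (hδ : 0 < δ)
    (x : EuclideanSpace ℝ (Fin d)) : |regDiv d s δ x| ≤ d * (δ ^ (s + 1))⁻¹ := by
  rw [abs_of_nonneg (regDiv_nonneg hs hδ x), regDiv]
  split_ifs with h
  · exact le_rfl
  · rw [not_lt] at h
    gcongr
    linarith

lemma integrable_mul_regDiv (hs0 : 0 < s) (hs : s ≤ (d : ℝ) - 1) (hδ : 0 < δ)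
    {η : EuclideanSpace ℝ (Fin d) → ℝ} (hη : IsLipZero η) (y : EuclideanSpace ℝ (Fin d)) :
    Integrable fun x => η x * regDiv d s δ (y - x) := by
  refine hη.integrable.mul_of_top_left (memLp_top_of_bound (C := d * (δ ^ (s + 1))⁻¹) ?_ ?_)
  · exact (measurable_regDiv.comp (measurable_const.sub measurable_id)).aestronglyMeasurable
  · exact Eventually.of_forall fun x => abs_regDiv_le hs0 hs hδ _

/-- Both factors are Lipschitz and one has compact support, so integration by parts applies. The
reflection `x ↦ y - x` absorbs its sign, and the sphere where the divergence formula fails is null.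
-/
lemma integral_mul_regDiv (hs0 : 0 < s) (hδ : 0 < δ)
    {η : EuclideanSpace ℝ (Fin d) → ℝ} (hη : IsLipZero η) (y : EuclideanSpace ℝ (Fin d)) :
    ∑ i, ∫ x, lineDeriv ℝ η x (EuclideanSpace.single i 1) * regKernel d s δ (y - x) i =
      ∫ x, η x * regDiv d s δ (y - x) := by
  obtain ⟨C, hC⟩ := exists_lipschitzWith_regKernel (d := d) hs0 hδ
  obtain ⟨Cη, hCη⟩ := hη.1
  have hlip : ∀ i, LipschitzWith C fun x => regKernel d s δ (y - x) i := by
    intro i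
    refine LipschitzWith.of_dist_le_mul fun a b => ?_
    have h1 := hC.dist_le_mul (y - a) (y - b)
    rw [dist_sub_left] at h1
    refine le_trans ?_ h1
    rw [dist_eq_norm, dist_eq_norm]
    exact PiLp.norm_apply_le (regKernel d s δ (y - a) - regKernel d s δ (y - b)) i
  have hderiv : ∀ i x, lineDeriv ℝ (fun x => regKernel d s δ (y - x) i) x
      (-EuclideanSpace.single i 1) =
      lineDeriv ℝ (fun u => regKernel d s δ u i) (y - x) (EuclideanSpace.single i 1) := by
    intro i x
    have e : ∀ t : ℝ, y - (x + t • -EuclideanSpace.single i (1 : ℝ)) =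
        y - x + t • EuclideanSpace.single i (1 : ℝ) := fun t => by
      rw [smul_neg, sub_add_eq_sub_sub, sub_neg_eq_add]
    simp only [lineDeriv, e]
  have hint : ∀ i, Integrable fun x => lineDeriv ℝ (fun u => regKernel d s δ u i) (y - x)
      (EuclideanSpace.single i 1) * η x := by
    intro i
    have := (hη.integrable (μ := volume)).mul_of_top_right
      ((hlip i).memLp_lineDeriv (μ := volume) (-EuclideanSpace.single i 1))
    refine this.congr (Eventually.of_forall fun x => ?_)
    simp only [Pi.mul_apply, hderiv]
  calc _ = ∑ i, ∫ x, lineDeriv ℝ (fun u => regKernel d s δ u i) (y - x)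
        (EuclideanSpace.single i 1) * η x := by
        refine Finset.sum_congr rfl fun i _ => ?_
        have := (hlip i).integral_lineDeriv_mul_eq (μ := volume) hCη hη.2
          (-EuclideanSpace.single i 1)
        simp only [neg_neg, hderiv] at this
        exact this.symm
    _ = ∫ x, ∑ i, lineDeriv ℝ (fun u => regKernel d s δ u i) (y - x)
        (EuclideanSpace.single i 1) * η x := (integral_finsetSum _ fun i _ => hint i).symm
    _ = _ := by
        refine integral_congr_ae ?_
        have hsph : ∀ᵐ x ∂(volume : Measure (EuclideanSpace ℝ (Fin d))), x ∉ Metric.sphere y δ :=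
          measure_eq_zero_iff_ae_notMem.1 (Measure.addHaar_sphere_of_ne_zero volume y hδ.ne')
        filter_upwards [hsph] with x hx
        rw [← Finset.sum_mul, sum_lineDeriv_regKernel hδ, mul_comm]
        rwa [Metric.mem_sphere, dist_comm, dist_eq_norm] at hx

lemma integral_lineDeriv_eq_zero {η : EuclideanSpace ℝ (Fin d) → ℝ} (hη : IsLipZero η)
    (v : EuclideanSpace ℝ (Fin d)) : ∫ x, lineDeriv ℝ η x v = 0 := by
  obtain ⟨C, hC⟩ := hη.1
  have h := (LipschitzWith.const (α := EuclideanSpace ℝ (Fin d)) (1 : ℝ)).integral_lineDeriv_mul_eq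
    (μ := volume) hC hη.2 (-v)
  have h0 : ∀ x, lineDeriv ℝ (fun _ : EuclideanSpace ℝ (Fin d) => (1 : ℝ)) x (-v) = 0 := fun x => by
    simp [lineDeriv]
  simpa [h0] using h.symm

lemma half_le_tent {z y : EuclideanSpace ℝ (Fin d)} {r : ℝ} (hr : 0 < r)
    (hy : ‖y - z‖ ≤ 3 / 2 * r) : 1 / 2 ≤ tent z r y := by
  refine le_max_of_le_right (le_min (by norm_num) ?_)
  have : ‖y - z‖ / r ≤ 3 / 2 := (div_le_iff₀ hr).2 hy
  linarith

/-- For `s = d - 1` the divergence vanishes outside the ball of radius `δ` but has total mass `d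
|B(0, 1)|` in it, whatever `δ` is. For `s < d - 1` it is at least a multiple of `r^(-s-1)` on the
whole ball of radius `r / 2`. -/
lemma exists_le_integral_tent_mul_regDiv (hs0 : 0 < s) (hs : s ≤ (d : ℝ) - 1) :
    ∃ c : ℝ, 0 < c ∧ ∀ (δ r : ℝ) (z y : EuclideanSpace ℝ (Fin d)), 0 < δ → δ ≤ r / 8 →
      ‖y - z‖ < r →
      c * r ^ ((d : ℝ) - 1 - s) ≤ ∫ x, tent z r x * regDiv d s δ (y - x) := by
  set v := volume.real (Metric.ball (0 : EuclideanSpace ℝ (Fin d)) 1) with hv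
  have hv0 : 0 < v := ENNReal.toReal_pos (Metric.measure_ball_pos _ _ one_pos).ne'
    measure_ball_lt_top.ne
  have hd : (0 : ℝ) < d := by linarith
  -- With `R ≤ r / 2`, the ball `B(y, R)` stays in `B(z, 3r/2)`, where the tent is at least `1/2`.
  have key : ∀ (δ r R A : ℝ) (z y : EuclideanSpace ℝ (Fin d)), 0 < δ → 0 < R → R ≤ r / 2 → 0 ≤ A →
      ‖y - z‖ < r → (∀ u : EuclideanSpace ℝ (Fin d), ‖u‖ < R → A ≤ regDiv d s δ u) →
      1 / 2 * A * (R ^ d * v) ≤ ∫ x, tent z r x * regDiv d s δ (y - x) := by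
    intro δ r R A z y hδ hR hRr hA hy hreg
    have hr : 0 < r := by linarith
    have hnn : ∀ x, 0 ≤ tent z r x * regDiv d s δ (y - x) := fun x =>
      mul_nonneg (tent_nonneg x) (regDiv_nonneg hs hδ _)
    have hint := integrable_mul_regDiv hs0 hs hδ (isLipZero_tent (z := z) hr) y
    have hvol : volume.real (Metric.ball y R) = R ^ d * v := by
      rw [Measure.real, Measure.addHaar_ball_of_pos _ _ hR, ENNReal.toReal_mul,
        ENNReal.toReal_ofReal (by positivity), finrank_euclideanSpace_fin, hv, Measure.real]
    calc 1 / 2 * A * (R ^ d * v) = ∫ x in Metric.ball y R, 1 / 2 * A := by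
          rw [setIntegral_const, hvol, smul_eq_mul, mul_comm]
      _ ≤ ∫ x in Metric.ball y R, tent z r x * regDiv d s δ (y - x) := by
          refine setIntegral_mono_on (integrableOn_const measure_ball_lt_top.ne) hint.integrableOn
            measurableSet_ball fun x hx => ?_
          rw [Metric.mem_ball, dist_eq_norm] at hx
          refine mul_le_mul (half_le_tent hr ?_) (hreg _ (by rwa [norm_sub_rev])) hA (tent_nonneg _)
          have := norm_add_le (x - y) (y - z)
          rw [sub_add_sub_cancel] at this
          linarith
      _ ≤ _ := setIntegral_le_integral hint (Eventually.of_forall hnn)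
  rcases hs.eq_or_lt with hsd | hsd
  · refine ⟨1 / 2 * d * v, by positivity, fun δ r z y hδ hδr hy => ?_⟩
    refine le_trans (le_of_eq ?_) (key δ r δ (d * (δ ^ (s + 1))⁻¹) z y hδ hδ (by linarith)
      (by positivity) hy fun u hu => ?_)
    · rw [hsd, sub_self, Real.rpow_zero, sub_add_cancel, Real.rpow_natCast]
      field_simp
    · rw [regDiv, if_pos hu]
  · have hgap : 0 < (d : ℝ) - (s + 1) := by linarith
    refine ⟨1 / 2 * (d - (s + 1)) * (1 / 2) ^ ((d : ℝ) - 1 - s) * v, by positivity,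
      fun δ r z y hδ hδr hy => ?_⟩
    have hr : 0 < r := by linarith
    refine le_trans (le_of_eq ?_) (key δ r (r / 2) ((d - (s + 1)) * ((r / 2) ^ (s + 1))⁻¹) z y hδ
      (by positivity) le_rfl (by positivity) hy fun u hu => ?_)
    · have e : (1 / 2 : ℝ) ^ ((d : ℝ) - 1 - s) * r ^ ((d : ℝ) - 1 - s) =
          ((r / 2) ^ (s + 1))⁻¹ * (r / 2) ^ d := by
        rw [← Real.mul_rpow (by norm_num) hr.le, ← Real.rpow_natCast, ← Real.rpow_neg (by positivity),
          ← Real.rpow_add (by positivity)]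
        congr 1 <;> ring
      linear_combination (1 / 2 * ((d : ℝ) - (s + 1)) * v) * e
    · rw [regDiv]
      split_ifs with hlt
      · have : (d : ℝ) - (s + 1) ≤ d := by linarith
        gcongr
        linarith
      · rw [not_lt] at hlt
        have : 0 < ‖u‖ := hδ.trans_le hlt
        gcongr

end Divergence

/-! ### Lebesgue averages of the mass of small balls. -/

section Average

variable {d : ℕ}

lemma measurable_measure_ball (μ : Measure (EuclideanSpace ℝ (Fin d))) [SFinite μ] (t : ℝ) :
    Measurable fun x => μ (Metric.ball x t) :=
  measurable_measure_prodMk_left (ν := μ)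
    (measurableSet_lt (measurable_snd.dist measurable_fst) measurable_const)

/-- On average a ball of radius `t` has mass proportional to `t^d`, which beats the pointwise bound
`Λ t^s`; the factor `κ^(d-s)` comes from this gain. -/
lemma integrableOn_measureReal_ball (μ : Measure (EuclideanSpace ℝ (Fin d)))
    [IsLocallyFiniteMeasure μ] {x : EuclideanSpace ℝ (Fin d)} {R t R' : ℝ} (hR : R + t ≤ R') :
    IntegrableOn (fun y => μ.real (Metric.ball y t)) (Metric.closedBall x R) ∧
    ∫ y in Metric.closedBall x R, μ.real (Metric.ball y t) ≤
      volume.real (Metric.ball (0 : EuclideanSpace ℝ (Fin d)) t) * μ.real (Metric.ball x R') := by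
  have hsub : ∀ y ∈ Metric.closedBall x R, Metric.ball y t ⊆ Metric.ball x R' := fun y hy =>
    Metric.ball_subset_ball' (by linarith [Metric.mem_closedBall.1 hy])
  have hm : Measurable fun y => μ.real (Metric.ball y t) :=
    (measurable_measure_ball μ t).ennreal_toReal
  refine ⟨?_, ?_⟩
  · refine Measure.integrableOn_of_bounded (M := μ.real (Metric.ball x R'))
      (isCompact_closedBall x R).measure_lt_top.ne hm.aestronglyMeasurable ?_
    filter_upwards [ae_restrict_mem Metric.isClosed_closedBall.measurableSet] with y hy
    rw [Real.norm_of_nonneg measureReal_nonneg]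
    exact measureReal_mono (hsub y hy) measure_ball_lt_top.ne
  · rw [integral_eq_lintegral_of_nonneg_ae (Eventually.of_forall fun _ => measureReal_nonneg)
      hm.aestronglyMeasurable, Measure.real, Measure.real, ← ENNReal.toReal_mul]
    refine ENNReal.toReal_mono (ENNReal.mul_lt_top measure_ball_lt_top measure_ball_lt_top).ne ?_
    rw [← lintegral_measure_inter_ball μ measurableSet_ball]
    refine le_trans (setLIntegral_mono' Metric.isClosed_closedBall.measurableSet fun y hy => ?_)
      (setLIntegral_le_lintegral _ _)
    rw [Measure.real, ENNReal.ofReal_toReal measure_ball_lt_top.ne,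
      Set.inter_eq_right.2 (hsub y hy)]

end Average

/-! ### Comparing the two bounds for the potential. -/

section Porosity

variable {d : ℕ} {s : ℝ}

lemma lineDeriv_tent_eq_zero {z x : EuclideanSpace ℝ (Fin d)} {r : ℝ} (hr : 0 < r)
    (hx : x ∉ Metric.closedBall z (2 * r)) (v : EuclideanSpace ℝ (Fin d)) :
    lineDeriv ℝ (tent z r) x v = 0 := by
  have h : tent z r =ᶠ[𝓝 x] fun _ => 0 := by
    filter_upwards [Metric.isClosed_closedBall.isOpen_compl.mem_nhds hx] with y hy
    rw [Set.mem_compl_iff, Metric.mem_closedBall, not_le, dist_eq_norm] at hy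
    exact tent_eq_zero hr hy.le
  rw [h.lineDeriv_eq]
  simp [lineDeriv]

lemma norm_lineDeriv_tent_le {z : EuclideanSpace ℝ (Fin d)} {r : ℝ} (hr : 0 < r) (i : Fin d)
    (x : EuclideanSpace ℝ (Fin d)) :
    ‖lineDeriv ℝ (tent z r) x (EuclideanSpace.single i 1)‖ ≤ r⁻¹ := by
  have hlip : LipschitzWith (Real.toNNReal r⁻¹) (tent z r) :=
    LipschitzWith.of_dist_le' fun x y => by
      rw [Real.dist_eq, dist_eq_norm]; exact abs_tent_sub_le hr x y
  have := norm_lineDeriv_le_of_lipschitz ℝ hlip (x₀ := x) (v := EuclideanSpace.single i (1 : ℝ))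
  rwa [PiLp.norm_single, norm_one, mul_one, Real.coe_toNNReal _ (inv_pos.2 hr).le] at this

lemma integrable_lineDeriv_tent {z : EuclideanSpace ℝ (Fin d)} {r : ℝ} (hr : 0 < r) (i : Fin d) :
    Integrable fun x => lineDeriv ℝ (tent z r) x (EuclideanSpace.single i 1) := by
  have h : IntegrableOn (fun x => lineDeriv ℝ (tent z r) x (EuclideanSpace.single i 1))
      (Metric.closedBall z (2 * r)) :=
    Measure.integrableOn_of_bounded (M := r⁻¹) (isCompact_closedBall z _).measure_lt_top.ne
      (measurable_lineDeriv (isLipZero_tent hr).continuous).aestronglyMeasurable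
      (Eventually.of_forall fun x => norm_lineDeriv_tent_le hr i x)
  refine (integrableOn_iff_integrable_of_support_subset fun x hx => ?_).1 h
  by_contra hc
  exact hx (lineDeriv_tent_eq_zero hr hc _)

/-- The divergence theorem for the potential of `μ`, tested against a tent function. -/
lemma integral_integral_tent_mul_regDiv_le {μ : Measure (EuclideanSpace ℝ (Fin d))}
    [IsLocallyFiniteMeasure μ] (hs0 : 0 < s) {Λ δ r : ℝ} (hΛ : 0 ≤ Λ)
    (hμ : IsNice s Λ μ) (hδ : 0 < δ) (hr : 0 < r) (z x₀ : EuclideanSpace ℝ (Fin d)) :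
    Integrable (fun y => ∫ x, tent z r x * regDiv d s δ (y - x)) μ ∧
    ∫ y, ∫ x, tent z r x * regDiv d s δ (y - x) ∂volume ∂μ ≤
      d * r⁻¹ * ∫ x in Metric.closedBall z (2 * r), ‖potDiff s δ μ x₀ x‖ := by
  set D : Fin d → EuclideanSpace ℝ (Fin d) → ℝ := fun i x =>
    lineDeriv ℝ (tent z r) x (EuclideanSpace.single i 1) with hD
  have hDi : ∀ i, Integrable (D i) := integrable_lineDeriv_tent hr
  have hD0 : ∀ i x, x ∉ Metric.closedBall z (2 * r) → D i x = 0 := fun i x hx =>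
    lineDeriv_tent_eq_zero hr hx _
  have hcK := continuous_regKernel (d := d) hs0 hδ
  have hF : ∀ i, Integrable (fun p : EuclideanSpace ℝ (Fin d) × EuclideanSpace ℝ (Fin d) =>
      D i p.2 • (regKernel d s δ (p.1 - p.2) - regKernel d s δ (p.1 - x₀))) (μ.prod volume) :=
    fun i => integrable_smul_regKernel_sub_sub (D := 2 * r + ‖z - x₀‖) hs0 hδ hΛ hμ (hDi i)
      fun y hy => by
        by_cases hyz : y ∈ Metric.closedBall z (2 * r)
        · rw [Metric.mem_closedBall, dist_eq_norm] at hyz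
          have := norm_add_le (y - z) (z - x₀)
          rw [sub_add_sub_cancel] at this
          linarith
        · exact absurd (hD0 i y hyz) hy
  set Q : Fin d → EuclideanSpace ℝ (Fin d) → EuclideanSpace ℝ (Fin d) := fun i y =>
    ∫ x, D i x • regKernel d s δ (y - x) with hQ
  have hKi : ∀ i y, Integrable fun x => D i x • regKernel d s δ (y - x) := fun i y =>
    (hDi i).smul_of_top_left (memLp_top_of_bound
      (Continuous.aestronglyMeasurable (by fun_prop)) (δ ^ (-s))
      (Eventually.of_forall fun p => norm_regKernel_le hs0 hδ _))
  -- A derivative of the tent has integral zero, so subtracting the fixed pole `x₀` changes nothing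
  -- and makes Fubini available.
  have hFQ : ∀ i y, ∫ x, D i x • (regKernel d s δ (y - x) - regKernel d s δ (y - x₀)) = Q i y := by
    intro i y
    simp only [smul_sub]
    rw [integral_sub (hKi i y) ((hDi i).smul_const _), integral_smul_const,
      integral_lineDeriv_eq_zero (isLipZero_tent hr), zero_smul, sub_zero]
  have hQi : ∀ i, Integrable (Q i) μ := fun i =>
    (hF i).integral_prod_left.congr (Eventually.of_forall (hFQ i))
  have hQU : ∀ i, ∫ y, Q i y ∂μ = ∫ x, D i x • potDiff s δ μ x₀ x := by
    intro i
    rw [← integral_congr_ae (Eventually.of_forall (hFQ i)), integral_integral_swap (hF i)]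
    refine integral_congr_ae (Eventually.of_forall fun y => ?_)
    simp only [potDiff]
    rw [integral_smul]
  have hcoord : ∀ (ν : Measure (EuclideanSpace ℝ (Fin d)))
      (g : EuclideanSpace ℝ (Fin d) → EuclideanSpace ℝ (Fin d)) (i : Fin d), Integrable g ν →
      ∫ x, g x i ∂ν = (∫ x, g x ∂ν) i := fun ν g i hg =>
    (EuclideanSpace.proj (𝕜 := ℝ) i).integral_comp_comm hg
  have hcoordi : ∀ i, Integrable (fun y => Q i y i) μ := fun i =>
    (EuclideanSpace.proj (𝕜 := ℝ) i).integrable_comp (hQi i)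
  have hdiv : ∀ y, ∑ i, Q i y i = ∫ x, tent z r x * regDiv d s δ (y - x) := by
    intro y
    rw [← integral_mul_regDiv hs0 hδ (isLipZero_tent hr)]
    refine Finset.sum_congr rfl fun i _ => ?_
    rw [hQ, ← hcoord _ _ _ (hKi i y)]
    rfl
  have hUc : Continuous (potDiff s δ μ x₀) := continuous_potDiff hs0 hδ hΛ hμ x₀
  have hUi : IntegrableOn (fun x => ‖potDiff s δ μ x₀ x‖) (Metric.closedBall z (2 * r)) :=
    hUc.norm.continuousOn.integrableOn_compact (isCompact_closedBall _ _)
  refine ⟨(integrable_finsetSum _ fun i _ => hcoordi i).congr (Eventually.of_forall hdiv), ?_⟩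
  calc _ = ∫ y, ∑ i, Q i y i ∂μ := (integral_congr_ae (Eventually.of_forall hdiv)).symm
    _ = ∑ i, (∫ x, D i x • potDiff s δ μ x₀ x) i := by
        rw [integral_finsetSum _ fun i _ => hcoordi i]
        refine Finset.sum_congr rfl fun i _ => ?_
        rw [hcoord _ _ _ (hQi i), hQU]
    _ ≤ ∑ _i : Fin d, r⁻¹ * ∫ x in Metric.closedBall z (2 * r), ‖potDiff s δ μ x₀ x‖ := by
        refine Finset.sum_le_sum fun i _ => ?_
        refine ((Real.le_norm_self _).trans (PiLp.norm_apply_le _ i)).trans ?_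
        rw [← integral_const_mul, ← integral_indicator Metric.isClosed_closedBall.measurableSet]
        refine norm_integral_le_of_norm_le
          (IntegrableOn.integrable_indicator (hUi.const_mul r⁻¹) Metric.isClosed_closedBall.measurableSet)
          (Eventually.of_forall fun x => ?_)
        by_cases hx : x ∈ Metric.closedBall z (2 * r)
        · rw [Set.indicator_of_mem hx, norm_smul]
          gcongr
          exact norm_lineDeriv_tent_le hr i x
        · rw [Set.indicator_of_notMem hx, hD0 i x hx, zero_smul, norm_zero]
    _ = _ := by
        rw [Finset.sum_const, Finset.card_univ, Fintype.card_fin, nsmul_eq_mul, mul_assoc]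

/-- If a reflectionless nice measure charges every ball `B(x,θδ)`, `x ∈ B(z,2r)`, then its mass in
`B(z,r)` is small. -/
lemma exists_measureReal_ball_le (hs0 : 0 < s) (hs : s ≤ (d : ℝ) - 1) :
    ∃ C : ℝ, 0 < C ∧ ∀ (Λ : ℝ) (μ : Measure (EuclideanSpace ℝ (Fin d))) [IsLocallyFiniteMeasure μ],
      0 ≤ Λ → IsNice s Λ μ → IsRieszReflectionless s μ →
      ∀ (z : EuclideanSpace ℝ (Fin d)) (r κ θ : ℝ), 0 < r → 0 < κ → κ ≤ 1 / 8 → 0 < θ → θ ≤ 1 / 2 →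
      (∀ x ∈ Metric.closedBall z (2 * r), 0 < μ (Metric.ball x (θ * (κ * r)))) →
      μ.real (Metric.ball z r) ≤ C * Λ * (θ + θ ^ (-s) * θ ^ (-s) * κ ^ ((d : ℝ) - s)) * r ^ s := by
  obtain ⟨c, hc0, hlow⟩ := exists_le_integral_tent_mul_regDiv hs0 hs
  obtain ⟨C, hC0, hup⟩ := exists_norm_potDiff_le (d := d) hs0 (by linarith)
  set v := volume.real (Metric.ball (0 : EuclideanSpace ℝ (Fin d)) 1) with hv
  have hv0 : 0 < v := ENNReal.toReal_pos (Metric.measure_ball_pos _ _ one_pos).ne'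
    measure_ball_lt_top.ne
  have hd : (0 : ℝ) < d := by linarith
  set C' := c⁻¹ * (d * (C * (2 ^ d * v + 2 * (3 ^ d * v * 3 ^ s)))) with hC'
  refine ⟨C', by positivity, fun Λ μ _ hΛ hμ hrefl z r κ θ hr hκ hκ8 hθ hθ2 hpos => ?_⟩
  set δ := κ * r with hδdef
  have hδ : 0 < δ := by positivity
  have hδr : δ ≤ r / 8 := by rw [hδdef]; nlinarith
  set S := Metric.closedBall z (2 * r) with hS
  have hSfin : volume S ≠ ∞ := (isCompact_closedBall z _).measure_lt_top.ne
  set V := volume.real S with hV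
  have hVeq : V = (2 * r) ^ d * v := by
    rw [hV, hS, Measure.real, Measure.addHaar_closedBall _ _ (by positivity), ENNReal.toReal_mul,
      ENNReal.toReal_ofReal (by positivity), finrank_euclideanSpace_fin, hv, Measure.real]
  have hV0 : 0 < V := by rw [hVeq]; positivity
  set T : EuclideanSpace ℝ (Fin d) → ℝ := fun x => μ.real (Metric.ball x (3 * δ)) with hT
  obtain ⟨hTi, hTle⟩ := integrableOn_measureReal_ball μ (x := z) (R := 2 * r) (t := 3 * δ)
    (R' := 3 * r) (by linarith)
  set J := ∫ x in S, T x with hJ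
  have hJle : J ≤ (3 * δ) ^ d * v * (Λ * (3 * r) ^ s) := by
    refine hTle.trans ?_
    have h1 : volume.real (Metric.ball (0 : EuclideanSpace ℝ (Fin d)) (3 * δ)) =
        (3 * δ) ^ d * v := by
      rw [Measure.real, Measure.addHaar_ball_of_pos _ _ (by positivity), ENNReal.toReal_mul,
        ENNReal.toReal_ofReal (by positivity), finrank_euclideanSpace_fin, hv, Measure.real]
    rw [h1]
    gcongr
    exact ENNReal.toReal_le_of_le_ofReal (by positivity) (hμ z (3 * r) (by positivity))
  -- The base point is chosen where the mass of the `3δ`-ball is at most its average, so its term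
  -- obeys the same bound as the averaged one.
  obtain ⟨x₀, hx₀S, hx₀⟩ := exists_le_setAverage (μ := volume)
    (fun h0 => hV0.ne' (by rw [hV, Measure.real, h0, ENNReal.toReal_zero])) hSfin hTi
  have hTx₀ : V * T x₀ ≤ J := by
    rw [setAverage_eq, smul_eq_mul, inv_mul_eq_div, le_div_iff₀ hV0, mul_comm] at hx₀
    exact hx₀
  set q := θ ^ (-s) * (θ * δ) ^ (-s) with hq
  have hq0 : 0 < q := by positivity
  have hUint : ∫ x in S, ‖potDiff s δ μ x₀ x‖ ≤ C * (Λ * θ * V + 2 * (q * J)) := by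
    have hTi' : IntegrableOn T S := hTi
    calc _ ≤ ∫ x in S, (C * (Λ * θ + q * T x₀) + C * q * T x) := by
          refine setIntegral_mono_on
            ((continuous_potDiff hs0 hδ hΛ hμ x₀).norm.continuousOn.integrableOn_compact
              (isCompact_closedBall _ _))
            ((integrableOn_const hSfin).add (hTi'.const_mul _))
            Metric.isClosed_closedBall.measurableSet fun x hx => ?_
          refine (hup Λ μ hΛ hμ hrefl x x₀ δ θ hδ hθ hθ2 (hpos x hx) (hpos x₀ hx₀S)).trans
            (le_of_eq ?_)
          simp only [hq, hT]; ring
      _ = C * (Λ * θ * V + q * (V * T x₀) + q * J) := by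
          have hc : IntegrableOn (fun _ => C * (Λ * θ + q * T x₀)) S := integrableOn_const hSfin
          rw [integral_add hc (hTi'.const_mul _), setIntegral_const, integral_const_mul,
            smul_eq_mul]
          ring
      _ ≤ C * (Λ * θ * V + q * J + q * J) := by gcongr
      _ = _ := by ring
  obtain ⟨hGi, hGle⟩ := integral_integral_tent_mul_regDiv_le hs0 hΛ hμ hδ hr z x₀
  have hGnn : ∀ y, 0 ≤ ∫ x, tent z r x * regDiv d s δ (y - x) := fun y =>
    integral_nonneg fun x => mul_nonneg (tent_nonneg x) (regDiv_nonneg hs hδ _)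
  have hlower : c * r ^ ((d : ℝ) - 1 - s) * μ.real (Metric.ball z r) ≤
      ∫ y, ∫ x, tent z r x * regDiv d s δ (y - x) ∂volume ∂μ := by
    calc _ = ∫ y in Metric.ball z r, c * r ^ ((d : ℝ) - 1 - s) ∂μ := by
          rw [setIntegral_const, smul_eq_mul, mul_comm]
      _ ≤ ∫ y in Metric.ball z r, ∫ x, tent z r x * regDiv d s δ (y - x) ∂volume ∂μ := by
          refine setIntegral_mono_on (integrableOn_const measure_ball_lt_top.ne) hGi.integrableOn
            measurableSet_ball fun y hy => ?_
          rw [Metric.mem_ball, dist_eq_norm] at hy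
          exact hlow δ r z y hδ hδr hy
      _ ≤ _ := setIntegral_le_integral hGi (Eventually.of_forall hGnn)
  set m := μ.real (Metric.ball z r) with hm
  have hchain : c * r ^ ((d : ℝ) - 1 - s) * m ≤ d * r⁻¹ * (C * (Λ * θ * ((2 * r) ^ d * v) +
      2 * (q * ((3 * δ) ^ d * v * (Λ * (3 * r) ^ s))))) := by
    rw [← hVeq]
    refine hlower.trans (hGle.trans ?_)
    gcongr
    refine hUint.trans ?_
    gcongr
  -- The volume of the `3δ`-ball gives `κ^d`, the factor `(θδ)^(-s)` gives `κ^(-s)`, and the powers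
  -- `r^(-s)` and `r^s` cancel.
  have e1 : q * ((3 * δ) ^ d * v * (Λ * (3 * r) ^ s)) =
      (3 ^ d * v * 3 ^ s) * Λ * (θ ^ (-s) * θ ^ (-s) * κ ^ ((d : ℝ) - s)) * r ^ d := by
    have a1 : (θ * δ) ^ (-s) = θ ^ (-s) * κ ^ (-s) * r ^ (-s) := by
      rw [hδdef, ← mul_assoc, Real.mul_rpow (by positivity) hr.le, Real.mul_rpow hθ.le hκ.le]
    have a2 : κ ^ ((d : ℝ) - s) = κ ^ d * κ ^ (-s) := by
      rw [sub_eq_add_neg, Real.rpow_add hκ, Real.rpow_natCast]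
    have a3 : r ^ (-s) * r ^ s = 1 := by rw [← Real.rpow_add hr]; simp
    rw [hq, a1, a2, hδdef, Real.mul_rpow (by norm_num) hr.le]
    linear_combination (θ ^ (-s) * θ ^ (-s) * κ ^ (-s) * 3 ^ d * κ ^ d * r ^ d * v * Λ * 3 ^ s) * a3
  have e2 : r ^ d * r⁻¹ = r ^ ((d : ℝ) - 1 - s) * r ^ s := by
    rw [← Real.rpow_add hr, ← Real.rpow_natCast, ← Real.rpow_neg_one, ← Real.rpow_add hr]
    congr 1; ring
  set W := θ ^ (-s) * θ ^ (-s) * κ ^ ((d : ℝ) - s) with hW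
  have hW0 : 0 ≤ W := by positivity
  have hfinal : c * r ^ ((d : ℝ) - 1 - s) * m ≤
      c * r ^ ((d : ℝ) - 1 - s) * (C' * Λ * (θ + W) * r ^ s) := by
    refine hchain.trans ?_
    rw [e1]
    calc d * r⁻¹ * (C * (Λ * θ * ((2 * r) ^ d * v) + 2 * ((3 ^ d * v * 3 ^ s) * Λ * W * r ^ d)))
        = (r ^ d * r⁻¹) * (d * (C * (Λ * ((2 ^ d * v) * θ + 2 * (3 ^ d * v * 3 ^ s) * W)))) := by
          ring
      _ ≤ (r ^ d * r⁻¹) * (d * (C * (Λ * ((2 ^ d * v + 2 * (3 ^ d * v * 3 ^ s)) * θ +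
            (2 ^ d * v + 2 * (3 ^ d * v * 3 ^ s)) * W)))) := by
          gcongr
          · exact le_add_of_nonneg_right (by positivity)
          · exact le_add_of_nonneg_left (by positivity)
      _ = _ := by
          rw [e2, hC']
          field_simp
  exact le_of_mul_le_mul_left hfinal (by positivity)

end Porosity

end Reflectionless

/-! ### Choice of constants and the main theorem. -/

theorem mainTheorem6 (d : ℕ) (s : ℝ) (hs_pos : 0 < s) (hs_le : s ≤ (d : ℝ) - 1)
    (Λ : ℝ) (hΛ : 0 < Λ) :
    (∀ ε : ℝ, 0 < ε → ∃ lam : ℝ, 0 < lam ∧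
      ∀ (μ : Measure (EuclideanSpace ℝ (Fin d))) [IsLocallyFiniteMeasure μ],
        Reflectionless.IsNice s Λ μ → Reflectionless.IsRieszReflectionless s μ →
        ∀ (x : EuclideanSpace ℝ (Fin d)) (r : ℝ), 0 < r →
          ENNReal.ofReal (ε * r ^ s) < μ (Metric.ball x r) →
          ∃ z : EuclideanSpace ℝ (Fin d),
            Metric.ball z (lam * r) ⊆ Metric.ball x (3 * r) ∧
            Disjoint (Metric.ball z (lam * r)) μ.support) ∧
    (∀ (μ : Measure (EuclideanSpace ℝ (Fin d))) [IsLocallyFiniteMeasure μ],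
        Reflectionless.IsNice s Λ μ → Reflectionless.IsRieszReflectionless s μ →
        IsNowhereDense μ.support) := by
  have hfirst : ∀ ε : ℝ, 0 < ε → ∃ lam : ℝ, 0 < lam ∧
      ∀ (μ : Measure (EuclideanSpace ℝ (Fin d))) [IsLocallyFiniteMeasure μ],
        Reflectionless.IsNice s Λ μ → Reflectionless.IsRieszReflectionless s μ →
        ∀ (x : EuclideanSpace ℝ (Fin d)) (r : ℝ), 0 < r →
          ENNReal.ofReal (ε * r ^ s) < μ (Metric.ball x r) →
          ∃ z : EuclideanSpace ℝ (Fin d),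
            Metric.ball z (lam * r) ⊆ Metric.ball x (3 * r) ∧
            Disjoint (Metric.ball z (lam * r)) μ.support := by
    intro ε hε
    obtain ⟨C, hC0, hC⟩ := Reflectionless.exists_measureReal_ball_le hs_pos hs_le
    -- Chosen so that `C Λ · 2θ ≤ ε`, with one `θ` for each of the two error terms.
    set θ := min (1 / 2) (ε / (2 * (C * Λ))) with hθdef
    have hθ : 0 < θ := by positivity
    have hθ2 : θ ≤ 1 / 2 := min_le_left _ _
    have hθε : C * Λ * (θ + θ) ≤ ε := by
      have : θ ≤ ε / (2 * (C * Λ)) := min_le_right _ _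
      rw [le_div_iff₀ (by positivity)] at this
      linarith
    -- Since `κ ≤ 1` and `d - s ≥ 1`, `κ^(d-s) ≤ κ ≤ θ^(1+2s)`, which brings the second error term
    -- down to `θ`.
    set κ := min (1 / 8) (θ ^ (1 + s + s)) with hκdef
    have hκ : 0 < κ := by positivity
    have hκ8 : κ ≤ 1 / 8 := min_le_left _ _
    have hκθ : θ ^ (-s) * θ ^ (-s) * κ ^ ((d : ℝ) - s) ≤ θ := by
      have h1 : κ ^ ((d : ℝ) - s) ≤ θ ^ (1 + s + s) :=
        (Real.rpow_le_rpow_of_exponent_ge (z := 1) hκ (by linarith) (by linarith)).trans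
          (by rw [Real.rpow_one]; exact min_le_right _ _)
      calc _ ≤ θ ^ (-s) * θ ^ (-s) * θ ^ (1 + s + s) := by gcongr
        _ = θ := by
            rw [← Real.rpow_add hθ, ← Real.rpow_add hθ]
            ring_nf
            exact Real.rpow_one θ
    refine ⟨θ * κ, by positivity, fun μ _ hμ hrefl x r hr hmass => ?_⟩
    by_contra! hcon
    have hsmall : θ * κ * r ≤ r := by
      have : θ * κ ≤ 1 := by nlinarith
      nlinarith
    -- A ball of radius `θκr ≤ r` centred in the closed ball of radius `2r` stays in `B(x, 3r)`;
    -- hence it meets the support and has positive mass.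
    have hpos : ∀ y ∈ Metric.closedBall x (2 * r), 0 < μ (Metric.ball y (θ * (κ * r))) := by
      intro y hy
      rw [← mul_assoc]
      have h1 := hcon y (Metric.ball_subset_ball' (by linarith [Metric.mem_closedBall.1 hy]))
      rw [Set.not_disjoint_iff] at h1
      obtain ⟨w, hw1, hw2⟩ := h1
      exact (Measure.mem_support_iff_forall w).1 hw2 _ (Metric.isOpen_ball.mem_nhds hw1)
    have h1 := hC Λ μ hΛ.le hμ hrefl x r κ θ hr hκ hκ8 hθ hθ2 hpos
    have h2 : μ.real (Metric.ball x r) ≤ ε * r ^ s := by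
      refine h1.trans ?_
      gcongr
      refine le_trans ?_ hθε
      gcongr
    rw [← ENNReal.ofReal_toReal (measure_ball_lt_top (μ := μ) (x := x) (r := r)).ne] at hmass
    exact absurd (ENNReal.ofReal_le_ofReal h2) (not_le.2 hmass)
  refine ⟨hfirst, fun μ _ hμ hrefl => ?_⟩
  rw [IsNowhereDense, Measure.isClosed_support.closure_eq, Set.eq_empty_iff_forall_notMem]
  intro x hx
  obtain ⟨R, hR, hball⟩ := Metric.isOpen_iff.1 isOpen_interior x hx
  have hsub : Metric.ball x R ⊆ μ.support := hball.trans interior_subset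
  set r := R / 3 with hr
  have hr0 : 0 < r := by positivity
  have hmass : 0 < μ (Metric.ball x r) :=
    (Measure.mem_support_iff_forall x).1 (hsub (Metric.mem_ball_self hR)) _
      (Metric.ball_mem_nhds x hr0)
  have hm : 0 < μ.real (Metric.ball x r) :=
    ENNReal.toReal_pos hmass.ne' measure_ball_lt_top.ne
  have hrs : 0 < r ^ s := by positivity
  -- Half the normalised mass gives the strict inequality. With `r = R / 3` the empty ball lies in
  -- `B(x, R)`, which is contained in the support.
  obtain ⟨lam, hlam, H⟩ := hfirst (μ.real (Metric.ball x r) / (2 * r ^ s)) (by positivity)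
  obtain ⟨z, hz1, hz2⟩ := H μ hμ hrefl x r hr0 (by
    rw [← ENNReal.ofReal_toReal (measure_ball_lt_top (μ := μ) (x := x) (r := r)).ne]
    refine (ENNReal.ofReal_lt_ofReal_iff hm).2 ?_
    rw [div_mul_eq_mul_div, mul_div_mul_right _ _ hrs.ne']
    exact half_lt_self hm)
  have hzmem : z ∈ Metric.ball z (lam * r) := Metric.mem_ball_self (by positivity)
  refine Set.disjoint_left.1 hz2 hzmem (hsub ?_)
  have := hz1 hzmem
  rwa [hr, mul_div_cancel₀ R (by norm_num : (3 : ℝ) ≠ 0)] at this
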